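/- Let $\alpha=(\alpha_1,\dots,\alpha_n)\in\mathbb{C}^n\setminus\{0\}$ with $|\alpha_1|=\cdots=|\alpha_n|\neq 1$, and let $M_\alpha=(\mathbb{C}^n\setminus\{0\})/\sim$ be the Hopf manifold, where $\sim$ is the equivalence relation generated by $(z_1,\dots,z_n)\sim(\alpha_1z_1,\dots,\alpha_nz_n)$. Put $r^2=\sum_{j}|z_j|^2$ and let $\omega_H=\sum_{i,j}\frac{\delta_{ij}}{r^2}\sqrt{-1}\,dz_i\wedge d\overline{z}_j$, a Hermitian metric on $M_\alpha$. Let $\psi\in C^\infty(M_\alpha;\mathbb{R})$ be such that $\omega_0=\omega_H+\sqrt{-1}\,\partial\overline{\partial}\psi$ is a Hermitian metric on $M_\alpha$ (that is, positive definite). Then there is a constant $C>0$ such that, for every smooth solution $\omega(t)$, $t\in[0,1/n)$, on $M_\alpha$ of the Chern-Ricci flow $$\frac{\partial}{\partial t}\omega=-\mathrm{Ric}(\omega),\qquad \omega|_{t=0}=\omega_0,$$ by Hermitian metrics, where $\mathrm{Ric}(\omega)=-\sqrt{-1}\,\partial\overline{\partial}\log\det g$ for $\omega=\sqrt{-1}\sum_{i,j}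 g_{i\overline{j}}\,dz_i\wedge d\overline{z}_j$, one has $$\omega(t)\le C\,\omega_H\quad\text{on } M_\alpha\text{ for all } t\in[0,1/n).$$ Here $\omega\le\omega'$ means that the real $(1,1)$-form $\omega'-\omega$ is nonnegative at every point. -/

import Mathlib

open Set
open scoped ContDiff ComplexOrder

noncomputable section

/-- The punctured space `ℂⁿ \ {0}`. -/
abbrev PuncturedSpace (n : ℕ) : Type := {z : Fin n → ℂ // z ≠ 0}

/-- The Hopf manifold `M_α = (ℂⁿ \ {0}) / ∼`, the quotient by the equivalence relation generated by
`(z₁, …, zₙ) ∼ (α₁ z₁, …, αₙ zₙ)`. -/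
def HopfManifold {n : ℕ} (α : Fin n → ℂ) : Type :=
  Quot (fun z w : PuncturedSpace n => (w : Fin n → ℂ) = α * (z : Fin n → ℂ))

namespace HopfManifold

variable {n : ℕ}

/-- The projection `ℂⁿ \ {0} → M_α`. When the `α i` are nonzero of equal modulus `≠ 1` it is a
holomorphic covering whose deck group is generated by `z ↦ α * z`; its local inverses are the
holomorphic charts of `M_α`. -/
def proj (α : Fin n → ℂ) (z : PuncturedSpace n) : HopfManifold α := Quot.mk _ z

/-- A function on `M_α`, read in the coordinates `z` of the charts (that is, pulled back to
`ℂⁿ \ {0}`). The value at the excluded point `z = 0` is never used. -/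
def pullback {α : Fin n → ℂ} (ψ : HopfManifold α → ℝ) (z : Fin n → ℂ) : ℝ :=
  open Classical in if h : z ≠ 0 then ψ (proj α ⟨z, h⟩) else 0

/-- `ψ ∈ C^∞(M_α)`: `ψ` is smooth in every chart of `M_α`. -/
def IsSmooth {α : Fin n → ℂ} (ψ : HopfManifold α → ℝ) : Prop :=
  ContDiffOn ℝ ∞ (pullback ψ) {z | z ≠ 0}

end HopfManifold

section Forms

variable {n : ℕ}

/-- `∂f/∂z_i = (∂f/∂x_i - √-1 ∂f/∂y_i) / 2`. -/
def wirtinger (i : Fin n) (f : (Fin n → ℂ) → ℂ) (z : Fin n → ℂ) : ℂ :=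
  (fderiv ℝ f z (Pi.single i 1) - Complex.I * fderiv ℝ f z (Pi.single i Complex.I)) / 2

/-- `∂f/∂z̄_i = (∂f/∂x_i + √-1 ∂f/∂y_i) / 2`. -/
def wirtingerBar (i : Fin n) (f : (Fin n → ℂ) → ℂ) (z : Fin n → ℂ) : ℂ :=
  (fderiv ℝ f z (Pi.single i 1) + Complex.I * fderiv ℝ f z (Pi.single i Complex.I)) / 2

/-- A field of matrices `g z i j` on `ℂⁿ \ {0}` stands for the `(1,1)`-form
`√-1 ∑ g_{i j̄} dz_i ∧ dz̄_j`. Values at `z = 0` are never used. -/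
abbrev FormCoeff (n : ℕ) : Type := (Fin n → ℂ) → Matrix (Fin n) (Fin n) ℂ

/-- The coefficients `∂_i ∂_j̄ f` of the form `√-1 ∂∂̄ f`, for a real function `f`. -/
def ddbar (f : (Fin n → ℂ) → ℝ) : FormCoeff n := fun z =>
  Matrix.of fun i j => wirtinger i (wirtingerBar j (fun w => (f w : ℂ))) z

/-- `r² = ∑ |z_j|²`. -/
def rSq (z : Fin n → ℂ) : ℝ := ∑ j, ‖z j‖ ^ 2

/-- The form `ω_H`, with coefficients `δ_{ij} / r²`. -/
def hopfForm (n : ℕ) : FormCoeff n := fun z =>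
  Matrix.of fun i j => if i = j then ((1 / rSq z : ℝ) : ℂ) else 0

/-- The coefficients on `ℂⁿ \ {0}` are those of a `(1,1)`-form on `M_α`: they obey the transformation
law of a `(1,1)`-form under the coordinate change `z ↦ α * z`. -/
def DescendsToHopf (α : Fin n → ℂ) (g : FormCoeff n) : Prop :=
  ∀ z : Fin n → ℂ, z ≠ 0 → ∀ i j, g (α * z) i j * (α i * star (α j)) = g z i j

/-- `g` gives the coefficients of a (smooth) Hermitian metric on `M_α`. -/
structure IsHermitianMetric (α : Fin n → ℂ) (g : FormCoeff n) : Prop where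
  descends : DescendsToHopf α g
  smooth : ∀ i j, ContDiffOn ℝ ∞ (fun z => g z i j) {z | z ≠ 0}
  posDef : ∀ z, z ≠ 0 → (g z).PosDef

/-- The Chern-Ricci form `Ric(ω) = -√-1 ∂∂̄ log det g`. (For a Hermitian metric `det g` is a
positive real number.) -/
def chernRicci (g : FormCoeff n) : FormCoeff n := fun z =>
  -ddbar (fun w => Real.log ((g w).det.re)) z

/-- `ω(t)`, `t ∈ [0,T)`, is a (smooth) solution on `M_α` of the Chern-Ricci flow
`∂ω/∂t = -Ric(ω)` starting at `ω₀`, where `ω(t)` and `ω₀`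
have coefficients `g t` and `g₀`. At `t = 0` the time derivative is one-sided. -/
structure IsChernRicciFlow (α : Fin n → ℂ) (g₀ : FormCoeff n) (T : ℝ) (g : ℝ → FormCoeff n) :
    Prop where
  metric : ∀ t ∈ Ico 0 T, IsHermitianMetric α (g t)
  smooth : ∀ i j, ContDiffOn ℝ ∞ (fun p : ℝ × (Fin n → ℂ) => g p.1 p.2 i j)
    (Ico 0 T ×ˢ {z | z ≠ 0})
  initial : ∀ z, z ≠ 0 → g 0 z = g₀ z
  flow : ∀ t ∈ Ico 0 T, ∀ z, z ≠ 0 → ∀ i j,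
    HasDerivWithinAt (fun s => g s z i j) (-(chernRicci (g t) z i j)) (Ico 0 T) t

/-- The inequality `ω ≤ ω'` of real `(1,1)`-forms: `ω' - ω` is nonnegative at every point. -/
def FormLE (g g' : FormCoeff n) : Prop := ∀ z, z ≠ 0 → (g' z - g z).PosSemidef

end Forms

end

/-!
The proof is a maximum principle for `u = tr_{ω_H} ω(t) = r² ∑ g_iī`, applied directly to the flow;
no potential and no estimate depending on the degeneration of the reference metrics as `t → 1/n`
enter.

The Chern-Ricci form is locally `∂∂̄`-exact, so `ω(t)` keeps the torsion `∂ω(t) = ∂ω_H`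
(`IsChernRicciFlow.sameTorsion`), which allows commuting indices in `∂_i ∂_ī g_kl̄` at the cost of
explicit terms in `z` (`SameTorsion.sum_wirt_wirt`). Let `H = g⁻¹` and
`p = ∑ H_lk z̄_k z_l / r²`, so that `0 ≤ p ≤ tr H`. At a spatial maximum of `u` the first derivatives
of `∑ g_iī` are `-(∑ g_iī) z̄_k / r²` and the complex Hessian of `u` is nonpositive. Expanding
`∂_i ∂_ī log det g = tr (H ∂_i ∂_ī g) - tr (H ∂_i g H ∂_ī g)`, bounding the quadratic term from below
by Cauchy-Schwarz (`Matrix.PosDef.re_contraction_le`) and collecting terms gives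
`r² ∂_t u ≤ (2 - u) (tr H - p) - (n - 1)² p / u`. Hence `∂_t u ≤ 0` at every spatial maximum with
`u ≥ 2` (`sum_ddbar_log_det_nonpos`), and `u ≤ max 2 (max u(0))` for all time
(`IsChernRicciFlow.hopfTrace_le`). A positive matrix being bounded by its trace, `ω(t) ≤ C ω_H`.
-/

/-! ### Wirtinger calculus -/

/-- The operator `(∂/∂x_k + c ∂/∂y_k) / 2`. It is `∂/∂z_k` for `c = -√-1` and `∂/∂z̄_k` for
`c = √-1`, so that the rules of calculus for the two operators can be proved together. -/
noncomputable def wirt {n : ℕ} (c : ℂ) (k : Fin n) (f : (Fin n → ℂ) → ℂ) (z : Fin n → ℂ) : ℂ :=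
  (fderiv ℝ f z (Pi.single k 1) + c * fderiv ℝ f z (Pi.single k Complex.I)) / 2

section Wirt

variable {n : ℕ} {c : ℂ} {k : Fin n} {f g : (Fin n → ℂ) → ℂ} {z : Fin n → ℂ}

lemma wirtinger_eq_wirt (k : Fin n) (f : (Fin n → ℂ) → ℂ) :
    wirtinger k f = wirt (-Complex.I) k f := by
  ext z
  simp [wirtinger, wirt, sub_eq_add_neg]

lemma wirtingerBar_eq_wirt (k : Fin n) (f : (Fin n → ℂ) → ℂ) :
    wirtingerBar k f = wirt Complex.I k f := rfl

lemma HasFDerivAt.wirt_eq {f' : (Fin n → ℂ) →L[ℝ] ℂ} (h : HasFDerivAt f f' z) :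
    wirt c k f z = (f' (Pi.single k 1) + c * f' (Pi.single k Complex.I)) / 2 := by
  rw [wirt, h.fderiv]

lemma Filter.EventuallyEq.wirt_eq (h : f =ᶠ[nhds z] g) : wirt c k f z = wirt c k g z := by
  rw [wirt, wirt, h.fderiv_eq]

lemma wirt_congr_on (h : ∀ w, w ≠ 0 → f w = g w) (hz : z ≠ 0) :
    wirt c k f z = wirt c k g z :=
  Filter.EventuallyEq.wirt_eq <| by
    filter_upwards [isOpen_ne.mem_nhds hz] with w hw using h w hw

lemma wirt_const (a : ℂ) : wirt c k (fun _ => a) z = 0 := by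
  simp [(hasFDerivAt_const a z).wirt_eq]

lemma wirt_add (hf : DifferentiableAt ℝ f z) (hg : DifferentiableAt ℝ g z) :
    wirt c k (fun w => f w + g w) z = wirt c k f z + wirt c k g z := by
  rw [(hf.hasFDerivAt.fun_add hg.hasFDerivAt).wirt_eq, wirt, wirt]
  simp only [_root_.add_apply]
  ring

lemma wirt_sub (hf : DifferentiableAt ℝ f z) (hg : DifferentiableAt ℝ g z) :
    wirt c k (fun w => f w - g w) z = wirt c k f z - wirt c k g z := by
  rw [(hf.hasFDerivAt.fun_sub hg.hasFDerivAt).wirt_eq, wirt, wirt]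
  simp only [_root_.sub_apply]
  ring

lemma wirt_neg : wirt c k (fun w => -f w) z = -wirt c k f z := by
  rw [wirt, wirt, fderiv_fun_neg]
  simp only [_root_.neg_apply]
  ring

lemma wirt_mul (hf : DifferentiableAt ℝ f z) (hg : DifferentiableAt ℝ g z) :
    wirt c k (fun w => f w * g w) z = wirt c k f z * g z + f z * wirt c k g z := by
  rw [(hf.hasFDerivAt.fun_mul hg.hasFDerivAt).wirt_eq, wirt, wirt]
  simp only [_root_.add_apply, _root_.smul_apply, smul_eq_mul]
  ring

lemma wirt_const_mul (a : ℂ) (hf : DifferentiableAt ℝ f z) :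
    wirt c k (fun w => a * f w) z = a * wirt c k f z := by
  rw [wirt_mul (differentiableAt_const a) hf, wirt_const, zero_mul, zero_add]

lemma wirt_sum {ι : Type*} (s : Finset ι) {F : ι → (Fin n → ℂ) → ℂ}
    (hF : ∀ i ∈ s, DifferentiableAt ℝ (F i) z) :
    wirt c k (fun w => ∑ i ∈ s, F i w) z = ∑ i ∈ s, wirt c k (F i) z := by
  rw [(HasFDerivAt.fun_sum fun i hi => (hF i hi).hasFDerivAt).wirt_eq]
  simp only [wirt, _root_.sum_apply, Finset.mul_sum, Finset.sum_div, ←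
    Finset.sum_add_distrib]

lemma wirt_conj : wirt c k (fun w => star (f w)) z = star (wirt (star c) k f z) := by
  have h : fderiv ℝ (fun w => star (f w)) z =
      (Complex.conjCLE : ℂ →L[ℝ] ℂ).comp (fderiv ℝ f z) :=
    Complex.conjCLE.comp_fderiv
  rw [wirt, h, wirt]
  simp

lemma wirt_inv (hf : DifferentiableAt ℝ f z) (h0 : f z ≠ 0) :
    wirt c k (fun w => (f w)⁻¹) z = -wirt c k f z / f z ^ 2 := by
  have h1 : DifferentiableAt ℝ (fun w => (f w)⁻¹) z := hf.inv h0
  have h2 : wirt c k (fun w => f w * (f w)⁻¹) z = 0 := by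
    rw [Filter.EventuallyEq.wirt_eq (g := fun _ => 1), wirt_const]
    filter_upwards [hf.continuousAt.eventually_ne h0] with w hw using mul_inv_cancel₀ hw
  rw [wirt_mul hf h1] at h2
  field_simp at h2 ⊢
  linear_combination h2

lemma isOpen_punctured : IsOpen {z : Fin n → ℂ | z ≠ 0} := isOpen_ne

lemma ContDiffOn.differentiableAt_punctured {F : Type*} [NormedAddCommGroup F] [NormedSpace ℝ F]
    {f : (Fin n → ℂ) → F} (hf : ContDiffOn ℝ ∞ f {z | z ≠ 0}) (hz : z ≠ 0) :
    DifferentiableAt ℝ f z :=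
  (hf.contDiffAt (isOpen_punctured.mem_nhds hz)).differentiableAt (by simp)

lemma ContDiffOn.wirt (hf : ContDiffOn ℝ ∞ f {z | z ≠ 0}) :
    ContDiffOn ℝ ∞ (wirt c k f) {z | z ≠ 0} := by
  have h : ContDiffOn ℝ ∞ (fderiv ℝ f) {z | z ≠ 0} :=
    hf.fderiv_of_isOpen isOpen_punctured (by simp)
  exact ((h.clm_apply contDiffOn_const).add
    (contDiffOn_const.mul (h.clm_apply contDiffOn_const))).div_const 2

lemma wirt_comm {c' : ℂ} {l : Fin n} (hf : ContDiffOn ℝ ∞ f {z | z ≠ 0}) (hz : z ≠ 0) :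
    wirt c k (wirt c' l f) z = wirt c' l (wirt c k f) z := by
  have hat := hf.contDiffAt (isOpen_punctured.mem_nhds hz)
  have hsymm : IsSymmSndFDerivAt ℝ f z := hat.isSymmSndFDerivAt (by
    simp only [minSmoothness_of_isRCLikeNormedField]
    exact WithTop.coe_le_coe.2 le_top)
  have h2 : DifferentiableAt ℝ (fderiv ℝ f) z :=
    (hf.fderiv_of_isOpen (m := ∞) isOpen_punctured (by simp)).differentiableAt_punctured hz
  have key : ∀ (d : ℂ) (m : Fin n), HasFDerivAt (_root_.wirt d m f)
      ((2⁻¹ : ℂ) • ((fderiv ℝ (fderiv ℝ f) z).flip (Pi.single m 1) +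
        d • (fderiv ℝ (fderiv ℝ f) z).flip (Pi.single m Complex.I))) z := by
    intro d m
    have e (v : Fin n → ℂ) : HasFDerivAt (fun w => fderiv ℝ f w v)
        ((fderiv ℝ (fderiv ℝ f) z).flip v) z := by
      have := h2.hasFDerivAt.clm_apply (hasFDerivAt_const v z)
      simpa using this
    have := ((e (Pi.single m 1)).add ((e (Pi.single m Complex.I)).const_mul d)).const_mul
      (2⁻¹ : ℂ)
    refine this.congr_of_eventuallyEq (Filter.Eventually.of_forall fun w => ?_)
    simp only [_root_.wirt, Pi.add_apply]
    ring
  rw [(key c' l).wirt_eq, (key c k).wirt_eq]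
  simp only [_root_.smul_apply, _root_.add_apply,
    ContinuousLinearMap.flip_apply, smul_eq_mul]
  have s (v w : Fin n → ℂ) : fderiv ℝ (fderiv ℝ f) z v w = fderiv ℝ (fderiv ℝ f) z w v :=
    hsymm v w
  rw [s (Pi.single l 1) (Pi.single k 1), s (Pi.single l 1) (Pi.single k Complex.I),
    s (Pi.single l Complex.I) (Pi.single k 1), s (Pi.single l Complex.I) (Pi.single k Complex.I)]
  ring

lemma wirt_coord (k j : Fin n) :
    wirt c k (fun w => w j) z = if j = k then (1 + c * Complex.I) / 2 else 0 := by
  rw [(hasFDerivAt_apply (𝕜 := ℝ) j z).wirt_eq]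
  by_cases h : j = k
  · subst h; simp
  · simp [h]

end Wirt

/-! ### Matrix inequalities -/

section MatrixInequalities

variable {n : ℕ}

/-- The trace of the product of a positive semidefinite matrix with a matrix of nonnegative
Hermitian form is nonnegative. -/
lemma Matrix.PosSemidef.re_trace_mul_nonneg {H K : Matrix (Fin n) (Fin n) ℂ} (hH : H.PosSemidef)
    (hK : ∀ v : Fin n → ℂ, 0 ≤ (star v ⬝ᵥ (K.mulVec v)).re) : 0 ≤ (H * K).trace.re := by
  obtain ⟨m, v, rfl⟩ := Matrix.posSemidef_iff_eq_sum_vecMulVec.1 hH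
  rw [Finset.sum_mul, Matrix.trace_sum, Complex.re_sum]
  refine Finset.sum_nonneg fun i _ => ?_
  rw [Matrix.vecMulVec_mul, Matrix.trace_vecMulVec, dotProduct_comm, ← Matrix.dotProduct_mulVec]
  exact hK (v i)

lemma Matrix.PosSemidef.re_trace_sandwich_nonneg {H : Matrix (Fin n) (Fin n) ℂ}
    (hH : H.PosSemidef) (W : Matrix (Fin n) (Fin n) ℂ) :
    0 ≤ (H * W * H * W.conjTranspose).trace.re := by
  have h := (hH.mul_mul_conjTranspose_same W)
  have := hH.re_trace_mul_nonneg fun v => (Complex.le_def.1 (h.dotProduct_mulVec_nonneg v)).1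
  simpa only [Matrix.mul_assoc] using this

/-- A Cauchy-Schwarz inequality: the contraction `X_k = ∑ i, A i k i` of a tensor `A` satisfies
`|X|² ≤ tr G · ∑ i, |A i|²`, where the norms are those of the dual metric `G⁻¹`. -/
lemma Matrix.PosDef.re_contraction_le {G : Matrix (Fin n) (Fin n) ℂ} (hG : G.PosDef)
    (A : Fin n → Matrix (Fin n) (Fin n) ℂ) {X : Fin n → ℂ} (hX : ∀ k, X k = ∑ i, A i k i)
    (hS : 0 < G.trace.re) :
    (star X ⬝ᵥ (G⁻¹.mulVec X)).re ≤
      G.trace.re * ∑ i, (G⁻¹ * A i * G⁻¹ * (A i).conjTranspose).trace.re := by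
  set H := G⁻¹ with hH
  have hHpsd : H.PosSemidef := hG.inv.posSemidef
  have hHh : H.conjTranspose = H := hHpsd.isHermitian
  have hGH : G * H = 1 := Matrix.mul_nonsing_inv _ ((Matrix.isUnit_iff_isUnit_det _).1 hG.isUnit)
  set S := G.trace.re with hSdef
  have hGre : ∀ i, G i i = ((G i i).re : ℂ) := fun i => by
    have : star (G i i) = G i i := hG.isHermitian.apply i i
    exact (Complex.conj_eq_iff_re.1 this).symm
  set q := star X ⬝ᵥ (H.mulVec X) with hq
  -- The inequality is `∑ i, tr (H Wᵢ H Wᵢᴴ) ≥ 0` for `Wᵢ = Aᵢ - S⁻¹ X eᵢᵀ G`, the components of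
  -- the `A i` orthogonal to the tensor `X eᵢᵀ G`.
  let Y : Fin n → Matrix (Fin n) (Fin n) ℂ := fun i => Matrix.vecMulVec X (G i)
  have hYH : ∀ i, Y i * H = Matrix.vecMulVec X (Pi.single i 1) := fun i => by
    simp only [Y]
    rw [Matrix.vecMulVec_mul]
    congr 1
    ext j
    have : (G * H) i j = (1 : Matrix (Fin n) (Fin n) ℂ) i j := by rw [hGH]
    rw [Matrix.one_apply] at this
    rw [Pi.single_apply]
    simp only [eq_comm (a := j)]
    rw [← this]
    rfl
  have cross : ∀ i, (H * A i * H * (Y i).conjTranspose).trace =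
      star X ⬝ᵥ (H.mulVec fun k => A i k i) := fun i => by
    have : H * (Y i).conjTranspose = Matrix.vecMulVec (Pi.single i 1) (star X) := by
      rw [← hHh, ← Matrix.conjTranspose_mul, hYH, Matrix.conjTranspose_vecMulVec]
      congr 1
      ext j
      simp [Pi.single_apply, apply_ite]
    rw [Matrix.mul_assoc, this, Matrix.mul_vecMulVec, Matrix.trace_vecMulVec, dotProduct_comm,
      ← Matrix.mulVec_mulVec]
    congr 2
    ext k
    simp
  have cross' : ∀ i, (H * Y i * H * (A i).conjTranspose).trace =
      star (star X ⬝ᵥ (H.mulVec fun k => A i k i)) := fun i => by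
    rw [← cross, ← Matrix.trace_conjTranspose]
    simp only [Matrix.conjTranspose_mul, Matrix.conjTranspose_conjTranspose, hHh]
    rw [Matrix.mul_assoc H (Y i), Matrix.mul_assoc H, Matrix.trace_mul_comm]
    simp only [Matrix.mul_assoc]
  have diag : ∀ i, (H * Y i * H * (Y i).conjTranspose).trace = G i i * q := fun i => by
    have e : H * Y i * H * (Y i).conjTranspose = H * (Y i * H) * (Y i).conjTranspose := by
      simp only [Matrix.mul_assoc]
    rw [e, hYH, Matrix.mul_vecMulVec, Matrix.conjTranspose_vecMulVec,
      Matrix.vecMulVec_mul_vecMulVec]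
    have h1 : (Pi.single i 1 : Fin n → ℂ) ⬝ᵥ star (G i) = G i i := by
      simp only [single_dotProduct, one_mul, Pi.star_apply]
      exact hG.isHermitian.apply i i
    rw [h1, Matrix.trace_vecMulVec, hq]
    simp [dotProduct_comm]
  have key : ∀ i, 0 ≤ (H * A i * H * (A i).conjTranspose).trace.re
      - 2 * S⁻¹ * (star X ⬝ᵥ (H.mulVec fun k => A i k i)).re + S⁻¹ ^ 2 * ((G i i).re * q.re) := by
    intro i
    have h := hHpsd.re_trace_sandwich_nonneg (A i - (S⁻¹ : ℂ) • Y i)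
    have e : H * (A i - (S⁻¹ : ℂ) • Y i) * H * (A i - (S⁻¹ : ℂ) • Y i).conjTranspose =
        H * A i * H * (A i).conjTranspose - (S⁻¹ : ℂ) • (H * A i * H * (Y i).conjTranspose)
        - (S⁻¹ : ℂ) • (H * Y i * H * (A i).conjTranspose)
        + ((S : ℂ)⁻¹ ^ 2) • (H * Y i * H * (Y i).conjTranspose) := by
      have hs : star ((S : ℂ)⁻¹) = (S : ℂ)⁻¹ := by simp
      rw [Matrix.conjTranspose_sub, Matrix.conjTranspose_smul, hs]
      simp only [Matrix.mul_sub, Matrix.sub_mul, Matrix.mul_smul, Matrix.smul_mul, smul_sub,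
        smul_smul, pow_two]
      abel
    rw [e, Matrix.trace_add, Matrix.trace_sub, Matrix.trace_sub, Matrix.trace_smul,
      Matrix.trace_smul, Matrix.trace_smul, cross, cross', diag, hGre i] at h
    simp only [← Complex.ofReal_inv, ← Complex.ofReal_pow, smul_eq_mul, Complex.add_re,
      Complex.sub_re, Complex.re_ofReal_mul, Complex.star_def, Complex.conj_re] at h
    linarith
  have hsum := Finset.sum_nonneg fun i (_ : i ∈ Finset.univ) => key i
  rw [Finset.sum_add_distrib, Finset.sum_sub_distrib, ← Finset.mul_sum, ← Finset.mul_sum,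
    ← Finset.sum_mul] at hsum
  have e1 : ∑ i, (star X ⬝ᵥ (H.mulVec fun k => A i k i)).re = q.re := by
    rw [← Complex.re_sum, ← dotProduct_sum, ← Matrix.mulVec_sum, hq]
    congr 3
    ext k
    simp [hX]
  have e2 : ∑ i, (G i i).re = S := by
    rw [hSdef, Matrix.trace, Complex.re_sum]
    rfl
  rw [e1, e2] at hsum
  have e3 : S⁻¹ ^ 2 * (S * q.re) = S⁻¹ * q.re := by field_simp
  rw [e3] at hsum
  have : S * (S⁻¹ * q.re) ≤ S * ∑ i, (H * A i * H * (A i).conjTranspose).trace.re :=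
    mul_le_mul_of_nonneg_left (by linarith) hS.le
  rwa [mul_inv_cancel_left₀ hS.ne'] at this

/-- A positive semidefinite matrix is bounded by its trace. -/
lemma Matrix.PosSemidef.smul_one_sub {G : Matrix (Fin n) (Fin n) ℂ} (hG : G.PosSemidef) {a : ℝ}
    (ha : G.trace.re ≤ a) : ((a : ℂ) • (1 : Matrix (Fin n) (Fin n) ℂ) - G).PosSemidef := by
  have hle : ∀ i, hG.isHermitian.eigenvalues i ≤ a := fun i => by
    rw [hG.isHermitian.trace_eq_sum_eigenvalues, Complex.re_sum] at ha
    simp only [Complex.coe_algebraMap, Complex.ofReal_re] at ha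
    exact (Finset.single_le_sum (fun j _ => hG.eigenvalues_nonneg j) (Finset.mem_univ i)).trans ha
  have e : (a : ℂ) • (1 : Matrix (Fin n) (Fin n) ℂ) - G =
      Unitary.conjStarAlgAut ℂ _ hG.isHermitian.eigenvectorUnitary
        (Matrix.diagonal fun i => ((a - hG.isHermitian.eigenvalues i : ℝ) : ℂ)) := by
    conv_lhs => rw [hG.isHermitian.spectral_theorem]
    rw [← map_one (Unitary.conjStarAlgAut ℂ _ hG.isHermitian.eigenvectorUnitary), ← map_smul,
      ← map_sub]
    congr 1
    ext i j
    by_cases h : i = j <;> simp [h]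
  rw [e, Unitary.conjStarAlgAut_apply]
  exact (Matrix.PosSemidef.diagonal fun i => by
    simpa using hle i).mul_mul_conjTranspose_same _

end MatrixInequalities

/-! ### Derivatives at a local maximum -/

section LocalMax

/-- The second derivative at a local maximum is nonpositive. -/
lemma IsLocalMax.fderiv_fderiv_nonpos {E : Type*} [NormedAddCommGroup E] [NormedSpace ℝ E]
    {u : E → ℝ} {z : E} (hu : ContDiffAt ℝ 2 u z) (hmax : IsLocalMax u z) (a : E) :
    fderiv ℝ (fderiv ℝ u) z a a ≤ 0 := by
  by_contra! hpos
  set φ : ℝ → ℝ := fun s => u (z + s • a) with hφ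
  have hline : ∀ s : ℝ, HasDerivAt (fun s : ℝ => z + s • a) a s := fun s => by
    simpa using ((hasDerivAt_id s).smul_const a).const_add z
  have hz0 : z + (0 : ℝ) • a = z := by simp
  have hcont : ContinuousAt (fun s : ℝ => z + s • a) 0 := (hline 0).continuousAt
  have htend : Filter.Tendsto (fun s : ℝ => z + s • a) (nhds 0) (nhds z) := by
    simpa [ContinuousAt] using hcont
  have hdiff : ∀ᶠ w in nhds z, DifferentiableAt ℝ u w :=
    (hu.eventually (by simp)).mono fun w hw => hw.differentiableAt (by simp)
  have hφ' : deriv φ =ᶠ[nhds 0] fun s => fderiv ℝ u (z + s • a) a := by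
    filter_upwards [htend.eventually hdiff] with s hs
    exact (hs.hasFDerivAt.comp_hasDerivAt s (hline s)).deriv
  have hD : DifferentiableAt ℝ (fderiv ℝ u) z :=
    (hu.fderiv_right (m := 1) (by norm_num)).differentiableAt (by simp)
  have hφ'' : deriv (deriv φ) 0 = fderiv ℝ (fderiv ℝ u) z a a := by
    rw [hφ'.deriv_eq]
    have h1 : HasDerivAt (fun s : ℝ => fderiv ℝ u (z + s • a)) (fderiv ℝ (fderiv ℝ u) z a) 0 :=
      (hz0.symm ▸ hD.hasFDerivAt : HasFDerivAt (fderiv ℝ u) (fderiv ℝ (fderiv ℝ u) z)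
        (z + (0 : ℝ) • a)).comp_hasDerivAt 0 (hline 0)
    have h2 := (ContinuousLinearMap.apply ℝ ℝ a).hasFDerivAt.comp_hasDerivAt (0 : ℝ) h1
    exact h2.deriv
  have hmaxφ : IsLocalMax φ 0 := by
    have := htend.eventually hmax
    filter_upwards [this] with s hs
    simpa [hφ] using hs
  have hφc : ContinuousAt φ 0 :=
    ContinuousAt.comp (f := fun s : ℝ => z + s • a) (g := u) (by rw [hz0]; exact hu.continuousAt)
      hcont
  -- A positive second derivative makes `0` a local minimum as well, so `φ` is locally constant.
  have hmin : IsLocalMin φ 0 :=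
    isLocalMin_of_deriv_deriv_pos (hφ''.symm ▸ hpos) hmaxφ.deriv_eq_zero hφc
  have hconst : φ =ᶠ[nhds 0] fun _ => φ 0 := by
    filter_upwards [hmin, hmaxφ] with s h1 h2 using le_antisymm h2 h1
  have h0 : deriv (deriv φ) 0 = 0 := by
    rw [hconst.deriv.deriv_eq]
    simp
  linarith

variable {n : ℕ} {u : (Fin n → ℂ) → ℝ} {z : Fin n → ℂ}

lemma wirt_ofReal (hu : DifferentiableAt ℝ u z) (c : ℂ) (k : Fin n) :
    wirt c k (fun w => (u w : ℂ)) z = ((fderiv ℝ u z (Pi.single k 1) : ℂ) +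
      c * (fderiv ℝ u z (Pi.single k Complex.I) : ℂ)) / 2 :=
  HasFDerivAt.wirt_eq (Complex.ofRealCLM.hasFDerivAt.comp z hu.hasFDerivAt)

lemma IsLocalMax.wirt_eq_zero (hmax : IsLocalMax u z) (hu : DifferentiableAt ℝ u z) (c : ℂ)
    (k : Fin n) : wirt c k (fun w => (u w : ℂ)) z = 0 := by
  rw [wirt_ofReal hu, hmax.fderiv_eq_zero]
  simp

/-- The complex Hessian at a local maximum is nonpositive. -/
lemma IsLocalMax.ddbar_nonpos (hmax : IsLocalMax u z) (hu : ContDiffOn ℝ ∞ u {z | z ≠ 0})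
    (hz : z ≠ 0) (v : Fin n → ℂ) : (star v ⬝ᵥ ((ddbar u z).mulVec v)).re ≤ 0 := by
  have hat : ContDiffAt ℝ ∞ u z := hu.contDiffAt (isOpen_punctured.mem_nhds hz)
  set B := fderiv ℝ (fderiv ℝ u) z with hB
  have hD : DifferentiableAt ℝ (fderiv ℝ u) z :=
    (hu.fderiv_of_isOpen (m := ∞) isOpen_punctured (by simp)).differentiableAt_punctured hz
  have e (x : Fin n → ℂ) : HasFDerivAt (fun w => ((fderiv ℝ u w x : ℝ) : ℂ))
      (Complex.ofRealCLM.comp (B.flip x)) z := by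
    have h := hD.hasFDerivAt.clm_apply (hasFDerivAt_const x z)
    exact Complex.ofRealCLM.hasFDerivAt.comp z (by simpa using h)
  have hU (k l : Fin n) : ddbar u z k l = ((B (Pi.single k 1) (Pi.single l 1) : ℂ) +
      Complex.I * (B (Pi.single k 1) (Pi.single l Complex.I) : ℂ) -
      Complex.I * ((B (Pi.single k Complex.I) (Pi.single l 1) : ℂ) +
      Complex.I * (B (Pi.single k Complex.I) (Pi.single l Complex.I) : ℂ))) / 4 := by
    rw [ddbar, Matrix.of_apply, wirtinger_eq_wirt, wirtingerBar_eq_wirt]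
    rw [wirt_congr_on (fun w hw => wirt_ofReal (hu.differentiableAt_punctured hw) _ _) hz]
    have h := ((e (Pi.single l 1)).add ((e (Pi.single l Complex.I)).const_mul
      Complex.I)).const_mul (2⁻¹ : ℂ)
    have h' : HasFDerivAt (fun w => ((fderiv ℝ u w (Pi.single l 1) : ℂ) +
      Complex.I * (fderiv ℝ u w (Pi.single l Complex.I) : ℂ)) / 2) _ z :=
      h.congr_of_eventuallyEq (Filter.Eventually.of_forall fun w => by
        simp only [Pi.add_apply]; ring)
    rw [h'.wirt_eq]
    simp only [_root_.smul_apply, _root_.add_apply, ContinuousLinearMap.comp_apply,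
      ContinuousLinearMap.flip_apply, smul_eq_mul, Complex.ofRealCLM_apply]
    ring
  have hle := hmax.fderiv_fderiv_nonpos (hat.of_le (WithTop.coe_le_coe.2 le_top))
  -- The direction `a = star v` and its rotation `√-1 a`, in real coordinates.
  set a : Fin n → ℂ := ∑ k, ((v k).re • (Pi.single k 1 : Fin n → ℂ) -
    (v k).im • (Pi.single k Complex.I : Fin n → ℂ))
  set b : Fin n → ℂ := ∑ k, ((v k).re • (Pi.single k Complex.I : Fin n → ℂ) +
    (v k).im • (Pi.single k 1 : Fin n → ℂ))
  have key : (star v ⬝ᵥ ((ddbar u z).mulVec v)).re = (B a a + B b b) / 4 := by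
    simp only [a, b, map_sum, _root_.sum_apply, map_add, map_sub, map_smul, _root_.add_apply,
      _root_.sub_apply, _root_.smul_apply, smul_eq_mul, dotProduct, Matrix.mulVec, hU,
      Finset.mul_sum, Complex.re_sum]
    rw [← Finset.sum_add_distrib, Finset.sum_div]
    rw [Finset.sum_comm]
    refine Finset.sum_congr rfl fun l _ => ?_
    simp only [← Finset.sum_sub_distrib, ← Finset.sum_add_distrib, Finset.sum_div]
    refine Finset.sum_congr rfl fun k _ => ?_
    simp only [Pi.star_apply, Complex.star_def, Complex.mul_re, Complex.mul_im, Complex.conj_re,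
      Complex.conj_im, Complex.div_ofNat_re, Complex.div_ofNat_im, Complex.add_re, Complex.add_im,
      Complex.sub_re, Complex.sub_im, Complex.I_re, Complex.I_im, Complex.ofReal_re,
      Complex.ofReal_im]
    ring
  rw [key]
  linarith [hle a, hle b]

end LocalMax

/-! ### Derivatives of `log det` -/

section LogDet

variable {n : ℕ} {g : FormCoeff n} {z : Fin n → ℂ} {c : ℂ} {k : Fin n}

/-- The entrywise derivative of a matrix-valued function. -/
noncomputable def wirtMatrix {n : ℕ} (c : ℂ) (k : Fin n) (g : FormCoeff n) : FormCoeff n :=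
  fun z => Matrix.of fun i j => wirt c k (fun w => g w i j) z

/-- Jacobi's formula. -/
lemma wirt_det (hg : ∀ i j, DifferentiableAt ℝ (fun w => g w i j) z) :
    wirt c k (fun w => (g w).det) z = ((g z).adjugate * wirtMatrix c k g z).trace := by
  let D : ContinuousMultilinearMap ℂ (fun _ : Fin n => Fin n → ℂ) ℂ :=
    { (Matrix.detRowAlternating (n := Fin n) (R := ℂ)).toMultilinearMap with
      cont := Continuous.matrix_det continuous_id }
  have h (i : Fin n) : HasFDerivAt (fun w => g w i)
      (ContinuousLinearMap.pi fun j => fderiv ℝ (fun w => g w i j) z) z :=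
    hasFDerivAt_pi.2 fun j => (hg i j).hasFDerivAt
  have hD := HasFDerivAt.multilinear_comp (f := D.restrictScalars ℝ) h
  have hdet (i : Fin n) (x : Fin n → ℂ) :
      D (Function.update (fun i => g z i) i x) = ∑ j, (g z).adjugate j i * x j := by
    have : D (Function.update (fun i => g z i) i x) = ((g z).updateRow i x).det := rfl
    rw [this, ← Matrix.cramer_transpose_apply, Matrix.cramer_eq_adjugate_mulVec,
      ← Matrix.adjugate_transpose]
    rfl
  have hD' : HasFDerivAt (fun w => (g w).det) _ z := hD
  rw [hD'.wirt_eq]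
  simp only [_root_.sum_apply, ContinuousLinearMap.comp_apply,
    ContinuousMultilinearMap.toContinuousLinearMap_apply,
    ContinuousMultilinearMap.coe_restrictScalars, hdet, ContinuousLinearMap.pi_apply]
  rw [Matrix.trace_mul_comm, Matrix.trace, Finset.mul_sum, ← Finset.sum_add_distrib,
    Finset.sum_div]
  refine Finset.sum_congr rfl fun i _ => ?_
  rw [Finset.mul_sum, ← Finset.sum_add_distrib, Finset.sum_div, Matrix.diag_apply,
    Matrix.mul_apply]
  refine Finset.sum_congr rfl fun j _ => ?_
  simp only [wirtMatrix, wirt, Matrix.of_apply]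
  ring

lemma contDiffOn_det (hg : ∀ i j, ContDiffOn ℝ ∞ (fun w => g w i j) {z | z ≠ 0}) :
    ContDiffOn ℝ ∞ (fun w => (g w).det) {z | z ≠ 0} := by
  simp only [Matrix.det_apply]
  exact ContDiffOn.sum fun σ _ => (contDiffOn_prod fun i _ => hg _ _).const_smul _

lemma contDiffOn_matrix_inv (hg : ∀ i j, ContDiffOn ℝ ∞ (fun w => g w i j) {z | z ≠ 0})
    (hpos : ∀ z, z ≠ 0 → (g z).PosDef) (i j : Fin n) :
    ContDiffOn ℝ ∞ (fun w => (g w)⁻¹ i j) {z | z ≠ 0} := by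
  simp only [Matrix.inv_def, Ring.inverse_eq_inv', Matrix.smul_apply, smul_eq_mul,
    Matrix.adjugate_apply]
  refine ((contDiffOn_det hg).inv fun w hw => (hpos w hw).det_pos.ne').mul
    (contDiffOn_det (g := fun w => (g w).updateRow j (Pi.single i 1)) fun a b => ?_)
  by_cases h : a = j
  · subst h
    simpa using contDiffOn_const
  · simpa [h] using hg a b

lemma contDiffOn_log_det (hg : ∀ i j, ContDiffOn ℝ ∞ (fun w => g w i j) {z | z ≠ 0})
    (hpos : ∀ z, z ≠ 0 → (g z).PosDef) :
    ContDiffOn ℝ ∞ (fun w => Real.log (g w).det.re) {z | z ≠ 0} :=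
  (Complex.reCLM.contDiff.comp_contDiffOn (contDiffOn_det hg)).log fun w hw =>
    (Complex.lt_def.1 (hpos w hw).det_pos).1.ne'

lemma wirt_log_det (hg : ∀ i j, ContDiffOn ℝ ∞ (fun w => g w i j) {z | z ≠ 0})
    (hpos : ∀ z, z ≠ 0 → (g z).PosDef) (hz : z ≠ 0) :
    wirt c k (fun w => (Real.log (g w).det.re : ℂ)) z =
      ((g z)⁻¹ * wirtMatrix c k g z).trace := by
  have hdet : ∀ w, w ≠ 0 → Complex.exp (Real.log (g w).det.re : ℂ) = (g w).det := by
    intro w hw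
    have h := Complex.lt_def.1 (hpos w hw).det_pos
    rw [← Complex.ofReal_exp, Real.exp_log h.1]
    exact Complex.ext rfl h.2
  have hF : DifferentiableAt ℝ (fun w => (Real.log (g w).det.re : ℂ)) z :=
    (Complex.ofRealCLM.contDiff.comp_contDiffOn
      (contDiffOn_log_det hg hpos)).differentiableAt_punctured hz
  have h1 : wirt c k (fun w => Complex.exp (Real.log (g w).det.re : ℂ)) z =
      (g z).det * wirt c k (fun w => (Real.log (g w).det.re : ℂ)) z := by
    rw [hF.hasFDerivAt.cexp.wirt_eq, hdet z hz, wirt]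
    simp only [_root_.smul_apply, smul_eq_mul]
    ring
  rw [wirt_congr_on hdet hz, wirt_det fun i j => (hg i j).differentiableAt_punctured hz] at h1
  have h0 : (g z).det ≠ 0 := (hpos z hz).det_pos.ne'
  rw [Matrix.inv_def, Ring.inverse_eq_inv', Matrix.smul_mul, Matrix.trace_smul, h1, smul_eq_mul,
    inv_mul_cancel_left₀ h0]

lemma wirtMatrix_inv (hg : ∀ i j, ContDiffOn ℝ ∞ (fun w => g w i j) {z | z ≠ 0})
    (hpos : ∀ z, z ≠ 0 → (g z).PosDef) (hz : z ≠ 0) :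
    wirtMatrix c k (fun w => (g w)⁻¹) z = -((g z)⁻¹ * wirtMatrix c k g z * (g z)⁻¹) := by
  have hunit : ∀ w, w ≠ 0 → IsUnit (g w).det := fun w hw =>
    (Matrix.isUnit_iff_isUnit_det _).1 (hpos w hw).isUnit
  have h : wirtMatrix c k (fun w => (g w)⁻¹) z * g z + (g z)⁻¹ * wirtMatrix c k g z = 0 := by
    ext i j
    have hi := fun m => (contDiffOn_matrix_inv hg hpos i m).differentiableAt_punctured hz
    have hj := fun m => (hg m j).differentiableAt_punctured hz
    have h1 : wirt c k (fun w => ∑ m, (g w)⁻¹ i m * g w m j) z = 0 := by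
      rw [wirt_congr_on (g := fun _ => (1 : Matrix (Fin n) (Fin n) ℂ) i j) _ hz, wirt_const]
      intro w hw
      rw [← Matrix.mul_apply, Matrix.nonsing_inv_mul _ (hunit w hw)]
    rw [wirt_sum _ fun m _ => (hi m).fun_mul (hj m)] at h1
    simp only [wirt_mul (hi _) (hj _), Finset.sum_add_distrib] at h1
    simpa [Matrix.mul_apply, wirtMatrix] using h1
  have h2 := congrArg (· * (g z)⁻¹) (eq_neg_of_add_eq_zero_left h)
  simpa [Matrix.mul_assoc, Matrix.mul_nonsing_inv _ (hunit z hz)] using h2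

/-- The second derivatives of `log det g`. -/
lemma wirt_wirt_log_det {c' : ℂ} {l : Fin n}
    (hg : ∀ i j, ContDiffOn ℝ ∞ (fun w => g w i j) {z | z ≠ 0})
    (hpos : ∀ z, z ≠ 0 → (g z).PosDef) (hz : z ≠ 0) :
    wirt c k (wirt c' l fun w => (Real.log (g w).det.re : ℂ)) z =
      ((g z)⁻¹ * wirtMatrix c k (wirtMatrix c' l g) z).trace -
      ((g z)⁻¹ * wirtMatrix c k g z * (g z)⁻¹ * wirtMatrix c' l g z).trace := by
  rw [wirt_congr_on (fun w hw => wirt_log_det hg hpos hw) hz]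
  have hi := fun i m => (contDiffOn_matrix_inv hg hpos i m).differentiableAt_punctured hz
  have hd : ∀ i m, DifferentiableAt ℝ (fun w => wirtMatrix c' l g w i m) z :=
    fun i m => ((hg i m).wirt (c := c') (k := l)).differentiableAt_punctured hz
  have h1 : wirt c k (fun w => ((g w)⁻¹ * wirtMatrix c' l g w).trace) z =
      (wirtMatrix c k (fun w => (g w)⁻¹) z * wirtMatrix c' l g z).trace +
      ((g z)⁻¹ * wirtMatrix c k (wirtMatrix c' l g) z).trace := by
    simp only [Matrix.trace, Matrix.diag_apply, Matrix.mul_apply]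
    rw [wirt_sum _ fun i _ => DifferentiableAt.fun_sum fun m _ => (hi i m).fun_mul (hd m i),
      ← Finset.sum_add_distrib]
    refine Finset.sum_congr rfl fun i _ => ?_
    rw [wirt_sum _ fun m _ => (hi i m).fun_mul (hd m i), ← Finset.sum_add_distrib]
    exact Finset.sum_congr rfl fun m _ => wirt_mul (hi i m) (hd m i)
  rw [h1, wirtMatrix_inv hg hpos hz, Matrix.neg_mul, Matrix.trace_neg]
  ring

end LogDet

/-! ### The Hopf metric and its torsion -/

section Hopf

variable {n : ℕ} {z : Fin n → ℂ}

lemma rSq_pos (hz : z ≠ 0) : 0 < rSq z := by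
  obtain ⟨i, hi⟩ := Function.ne_iff.1 hz
  exact Finset.sum_pos' (fun j _ => by positivity)
    ⟨i, Finset.mem_univ i, by have := norm_pos_iff.2 hi; positivity⟩

lemma ofReal_rSq (z : Fin n → ℂ) : (rSq z : ℂ) = ∑ j, z j * star (z j) := by
  rw [rSq, Complex.ofReal_sum]
  refine Finset.sum_congr rfl fun j _ => ?_
  rw [Complex.star_def, Complex.mul_conj, Complex.normSq_eq_norm_sq]

lemma contDiff_rSq : ContDiff ℝ ∞ (rSq : (Fin n → ℂ) → ℝ) :=
  ContDiff.sum fun j _ => (contDiff_apply ℝ ℂ j).norm_sq ℝ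

lemma contDiff_coe_rSq : ContDiff ℝ ∞ (fun w : Fin n → ℂ => (rSq w : ℂ)) :=
  Complex.ofRealCLM.contDiff.comp contDiff_rSq

lemma contDiffOn_one_div_rSq :
    ContDiffOn ℝ ∞ (fun w : Fin n → ℂ => ((1 / rSq w : ℝ) : ℂ)) {z | z ≠ 0} :=
  Complex.ofRealCLM.contDiff.comp_contDiffOn
    (contDiffOn_const.div contDiff_rSq.contDiffOn fun _ hw => (rSq_pos hw).ne')

lemma differentiableAt_coord (j : Fin n) : DifferentiableAt ℝ (fun w : Fin n → ℂ => w j) z :=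
  (hasFDerivAt_apply (𝕜 := ℝ) j z).differentiableAt

lemma differentiableAt_star_coord (j : Fin n) :
    DifferentiableAt ℝ (fun w : Fin n → ℂ => star (w j)) z :=
  Complex.conjCLE.differentiableAt.comp z (differentiableAt_coord j)

lemma wirt_rSq (c : ℂ) (k : Fin n) : wirt c k (fun w => (rSq w : ℂ)) z =
    (1 + c * Complex.I) / 2 * star (z k) + (1 - c * Complex.I) / 2 * z k := by
  simp only [ofReal_rSq]
  rw [wirt_sum _ fun j _ => (differentiableAt_coord j).fun_mul (differentiableAt_star_coord j)]
  simp only [wirt_mul (differentiableAt_coord _) (differentiableAt_star_coord _), wirt_conj,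
    wirt_coord, apply_ite star, ite_mul, mul_ite, star_zero, zero_mul, mul_zero,
    Finset.sum_add_distrib, Finset.sum_ite_eq', Finset.mem_univ, if_true]
  simp only [Complex.star_def, map_div₀, map_add, map_mul, map_one, Complex.conj_I,
    Complex.conj_conj, map_ofNat]
  ring

lemma wirtinger_rSq (k : Fin n) :
    wirt (-Complex.I) k (fun w => (rSq w : ℂ)) z = star (z k) := by
  rw [wirt_rSq]
  simp

lemma wirtingerBar_rSq (k : Fin n) : wirt Complex.I k (fun w => (rSq w : ℂ)) z = z k := by
  rw [wirt_rSq]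
  simp

lemma wirt_one_div_rSq (c : ℂ) (k : Fin n) (hz : z ≠ 0) :
    wirt c k (fun w => ((1 / rSq w : ℝ) : ℂ)) z =
      -wirt c k (fun w => (rSq w : ℂ)) z / (rSq z : ℂ) ^ 2 := by
  have e : (fun w : Fin n → ℂ => ((1 / rSq w : ℝ) : ℂ)) = fun w => (rSq w : ℂ)⁻¹ := by
    ext w
    push_cast
    rw [one_div]
  rw [e, wirt_inv (contDiff_coe_rSq.differentiable (by simp) z)
    (by exact_mod_cast (rSq_pos hz).ne')]

lemma wirtinger_wirtingerBar_one_div_rSq (k l : Fin n) (hz : z ≠ 0) :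
    wirt (-Complex.I) k (wirt Complex.I l fun w => ((1 / rSq w : ℝ) : ℂ)) z =
      -(if l = k then 1 else 0) / (rSq z : ℂ) ^ 2 + 2 * star (z k) * z l / (rSq z : ℂ) ^ 3 := by
  have h0 : (rSq z : ℂ) ≠ 0 := by exact_mod_cast (rSq_pos hz).ne'
  have hq := contDiffOn_one_div_rSq.differentiableAt_punctured hz
  have e : ∀ w, w ≠ 0 → wirt Complex.I l (fun w => ((1 / rSq w : ℝ) : ℂ)) w =
      -(w l * (((1 / rSq w : ℝ) : ℂ) * ((1 / rSq w : ℝ) : ℂ))) := fun w hw => by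
    rw [wirt_one_div_rSq _ _ hw, wirtingerBar_rSq]
    push_cast
    field_simp
  rw [wirt_congr_on e hz, wirt_neg, wirt_mul (differentiableAt_coord l) (hq.fun_mul hq),
    wirt_mul hq hq, wirt_one_div_rSq _ _ hz, wirtinger_rSq, wirt_coord]
  split_ifs with h
  · simp only [neg_mul, Complex.I_mul_I, neg_neg]
    push_cast
    field_simp
    ring
  · push_cast
    field_simp
    ring

lemma wirt_hopfForm (c : ℂ) (k i j : Fin n) : wirt c k (fun w => hopfForm n w i j) z =
    (if i = j then 1 else 0) * wirt c k (fun w => ((1 / rSq w : ℝ) : ℂ)) z := by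
  simp only [hopfForm, Matrix.of_apply]
  split_ifs
  · rw [one_mul]
  · rw [wirt_const, zero_mul]

/-- The `(1,1)`-forms with coefficients `g` and `h` have the same torsion `∂_k g_ij̄ - ∂_i g_kj̄` on
`ℂⁿ \ {0}`; that is, `∂ω_g = ∂ω_h`. -/
def SameTorsion (g h : FormCoeff n) : Prop :=
  ∀ z : Fin n → ℂ, z ≠ 0 → ∀ k i j,
    wirt (-Complex.I) k (fun w => g w i j) z - wirt (-Complex.I) i (fun w => g w k j) z =
    wirt (-Complex.I) k (fun w => h w i j) z - wirt (-Complex.I) i (fun w => h w k j) z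

variable {g : FormCoeff n}

lemma wirt_apply_conj (hherm : ∀ z, z ≠ 0 → (g z).IsHermitian) (hz : z ≠ 0) (c : ℂ)
    (k i j : Fin n) :
    wirt (star c) k (fun w => g w j i) z = star (wirt c k (fun w => g w i j) z) := by
  rw [wirt_congr_on (fun w hw => ((hherm w hw).apply j i).symm) hz, wirt_conj, star_star]

lemma SameTorsion.wirtinger_sub (ht : SameTorsion g (hopfForm n)) (hz : z ≠ 0) (k i j : Fin n) :
    wirt (-Complex.I) k (fun w => g w i j) z - wirt (-Complex.I) i (fun w => g w k j) z =
      (if i = j then 1 else 0) * wirt (-Complex.I) k (fun w => ((1 / rSq w : ℝ) : ℂ)) z -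
      (if k = j then 1 else 0) * wirt (-Complex.I) i (fun w => ((1 / rSq w : ℝ) : ℂ)) z := by
  rw [ht z hz, wirt_hopfForm, wirt_hopfForm]

lemma SameTorsion.wirtingerBar_sub (ht : SameTorsion g (hopfForm n))
    (hherm : ∀ z, z ≠ 0 → (g z).IsHermitian) (hz : z ≠ 0) (k i j : Fin n) :
    wirt Complex.I k (fun w => g w j i) z - wirt Complex.I i (fun w => g w j k) z =
      (if i = j then 1 else 0) * wirt Complex.I k (fun w => ((1 / rSq w : ℝ) : ℂ)) z -
      (if k = j then 1 else 0) * wirt Complex.I i (fun w => ((1 / rSq w : ℝ) : ℂ)) z := by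
  have hI : star (-Complex.I) = Complex.I := by simp
  have hq (m : Fin n) : star (wirt (-Complex.I) m (fun w => ((1 / rSq w : ℝ) : ℂ)) z) =
      wirt Complex.I m (fun w => ((1 / rSq w : ℝ) : ℂ)) z := by
    have e : (fun w : Fin n → ℂ => ((1 / rSq w : ℝ) : ℂ)) =
        fun w => star (((1 / rSq w : ℝ) : ℂ)) := by
      ext w
      exact (Complex.conj_ofReal _).symm
    conv_rhs => rw [e, wirt_conj]
    simp
  have h := congrArg star (ht.wirtinger_sub hz k i j)
  rw [star_sub, ← wirt_apply_conj hherm hz, ← wirt_apply_conj hherm hz, hI, star_sub, star_mul',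
    star_mul', hq, hq, apply_ite star, apply_ite star, star_one, star_zero] at h
  exact h

/-- The commutation formula: for a metric with the torsion of the Hopf metric,
`∑ i, ∂_i ∂_ī g_kl̄` differs from `∂_k ∂_l̄ (∑ i, g_iī)` as it does for the Hopf metric itself. -/
lemma SameTorsion.sum_wirt_wirt (ht : SameTorsion g (hopfForm n))
    (hg : ∀ i j, ContDiffOn ℝ ∞ (fun w => g w i j) {z | z ≠ 0})
    (hherm : ∀ z, z ≠ 0 → (g z).IsHermitian) (hz : z ≠ 0) (k l : Fin n) :
    ∑ i, wirt (-Complex.I) i (wirt Complex.I i fun w => g w k l) z =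
      wirt (-Complex.I) k (wirt Complex.I l fun w => (g w).trace) z +
        (if l = k then 2 else 0) / (rSq z : ℂ) ^ 2 -
        2 * n * star (z k) * z l / (rSq z : ℂ) ^ 3 := by
  set q : (Fin n → ℂ) → ℂ := fun w => ((1 / rSq w : ℝ) : ℂ) with hqdef
  have hq : ContDiffOn ℝ ∞ q {z | z ≠ 0} := contDiffOn_one_div_rSq
  have dq (c : ℂ) (m : Fin n) : DifferentiableAt ℝ (wirt c m q) z :=
    (hq.wirt (c := c) (k := m)).differentiableAt_punctured hz
  have dg (c : ℂ) (m i j : Fin n) : DifferentiableAt ℝ (wirt c m fun w => g w i j) z :=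
    ((hg i j).wirt (c := c) (k := m)).differentiableAt_punctured hz
  have step (i : Fin n) : wirt (-Complex.I) i (wirt Complex.I i fun w => g w k l) z =
      wirt (-Complex.I) k (wirt Complex.I l fun w => g w i i) z -
      wirt (-Complex.I) k (wirt Complex.I l q) z +
      (if k = l then 1 else 0) * wirt (-Complex.I) i (wirt Complex.I i q) z := by
    have e1 : ∀ w, w ≠ 0 → wirt (-Complex.I) i (fun w => g w k l) w =
        wirt (-Complex.I) k (fun w => g w i l) w + ((if k = l then 1 else 0) *
          wirt (-Complex.I) i q w - (if i = l then 1 else 0) * wirt (-Complex.I) k q w) :=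
      fun w hw => by linear_combination ht.wirtinger_sub hw i k l
    have e2 : ∀ w, w ≠ 0 → wirt Complex.I i (fun w => g w i l) w =
        wirt Complex.I l (fun w => g w i i) w + ((if l = i then 1 else 0) *
          wirt Complex.I i q w - wirt Complex.I l q w) :=
      fun w hw => by
        have := ht.wirtingerBar_sub hherm hw i l i
        rw [if_pos rfl] at this
        linear_combination this
    rw [wirt_comm (hg k l) hz, wirt_congr_on e1 hz,
      wirt_add (dg _ _ _ _) (((dq _ _).const_mul _).fun_sub ((dq _ _).const_mul _)),
      wirt_sub ((dq _ _).const_mul _) ((dq _ _).const_mul _), wirt_const_mul _ (dq _ _),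
      wirt_const_mul _ (dq _ _), wirt_comm (hg i l) hz, wirt_congr_on e2 hz,
      wirt_add (dg _ _ _ _) (((dq _ _).const_mul _).fun_sub (dq _ _)),
      wirt_sub ((dq _ _).const_mul _) (dq _ _), wirt_const_mul _ (dq _ _),
      wirt_comm (c := Complex.I) (k := i) (l := k) hq hz,
      wirt_comm (c := Complex.I) (k := i) (l := i) hq hz]
    simp only [eq_comm (a := l) (b := i)]
    ring
  have htr : wirt (-Complex.I) k (wirt Complex.I l fun w => (g w).trace) z =
      ∑ i, wirt (-Complex.I) k (wirt Complex.I l fun w => g w i i) z := by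
    rw [← wirt_sum _ fun i _ => dg _ _ _ _]
    refine wirt_congr_on (fun w hw => ?_) hz
    exact wirt_sum _ fun i _ => (hg i i).differentiableAt_punctured hw
  have hR : (rSq z : ℂ) ≠ 0 := by exact_mod_cast (rSq_pos hz).ne'
  have hlap : ∑ i, wirt (-Complex.I) i (wirt Complex.I i q) z = (2 - n) / (rSq z : ℂ) ^ 2 := by
    simp only [q, wirtinger_wirtingerBar_one_div_rSq _ _ hz, if_true]
    have : ∑ i, 2 * star (z i) * z i / (rSq z : ℂ) ^ 3 = 2 * (rSq z : ℂ) / (rSq z : ℂ) ^ 3 := by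
      rw [← Finset.sum_div]
      congr 1
      rw [ofReal_rSq, Finset.mul_sum]
      exact Finset.sum_congr rfl fun i _ => by ring
    rw [Finset.sum_add_distrib, this, Finset.sum_const, Finset.card_univ, Fintype.card_fin,
      nsmul_eq_mul]
    field_simp
    ring
  rw [Finset.sum_congr rfl fun i _ => step i, Finset.sum_add_distrib, Finset.sum_sub_distrib,
    ← htr, ← Finset.mul_sum, hlap, Finset.sum_const, Finset.card_univ, Fintype.card_fin,
    nsmul_eq_mul, wirtinger_wirtingerBar_one_div_rSq _ _ hz]
  simp only [eq_comm (a := l) (b := k)]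
  split_ifs <;> field_simp <;> ring

end Hopf

/-! ### The maximum principle estimate at a fixed time -/

section Spatial

variable {n : ℕ} {g : FormCoeff n} {z : Fin n → ℂ}

/-- The trace `tr_{ω_H} ω = r² ∑ g_iī` of a `(1,1)`-form with respect to the Hopf metric. -/
noncomputable def hopfTrace (g : FormCoeff n) (z : Fin n → ℂ) : ℝ := rSq z * (g z).trace.re

lemma contDiffOn_trace (hg : ∀ i j, ContDiffOn ℝ ∞ (fun w => g w i j) {z | z ≠ 0}) :
    ContDiffOn ℝ ∞ (fun w => (g w).trace) {z | z ≠ 0} :=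
  ContDiffOn.sum fun i _ => hg i i

lemma contDiffOn_hopfTrace (hg : ∀ i j, ContDiffOn ℝ ∞ (fun w => g w i j) {z | z ≠ 0}) :
    ContDiffOn ℝ ∞ (hopfTrace g) {z | z ≠ 0} :=
  contDiff_rSq.contDiffOn.mul (Complex.reCLM.contDiff.comp_contDiffOn (contDiffOn_trace hg))

lemma Matrix.IsHermitian.trace_eq_re {A : Matrix (Fin n) (Fin n) ℂ} (hA : A.IsHermitian) :
    A.trace = (A.trace.re : ℂ) :=
  (Complex.conj_eq_iff_re.1 (by
    rw [← Complex.star_def, ← Matrix.trace_conjTranspose, hA.eq])).symm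

lemma coe_hopfTrace (hA : (g z).IsHermitian) :
    (hopfTrace g z : ℂ) = (rSq z : ℂ) * (g z).trace := by
  rw [hopfTrace, Complex.ofReal_mul, ← hA.trace_eq_re]

/-- At a critical point of `tr_{ω_H} ω` the first derivatives of `∑ g_iī` are determined. -/
lemma wirt_trace_of_isLocalMax (hg : ∀ i j, ContDiffOn ℝ ∞ (fun w => g w i j) {z | z ≠ 0})
    (hherm : ∀ z, z ≠ 0 → (g z).IsHermitian) (hz : z ≠ 0) (hmax : IsLocalMax (hopfTrace g) z)
    (c : ℂ) (k : Fin n) : wirt c k (fun w => (g w).trace) z =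
      -wirt c k (fun w => (rSq w : ℂ)) z * (g z).trace / (rSq z : ℂ) := by
  have h := hmax.wirt_eq_zero ((contDiffOn_hopfTrace hg).differentiableAt_punctured hz) c k
  rw [wirt_congr_on (fun w hw => coe_hopfTrace (hherm w hw)) hz,
    wirt_mul (contDiff_coe_rSq.differentiable (by simp) z)
      ((contDiffOn_trace hg).differentiableAt_punctured hz)] at h
  have hR : (rSq z : ℂ) ≠ 0 := by exact_mod_cast (rSq_pos hz).ne'
  field_simp
  linear_combination h

/-- The complex Hessian of `tr_{ω_H} ω` at a local maximum in terms of that of `∑ g_iī`. -/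
lemma ddbar_hopfTrace_of_isLocalMax
    (hg : ∀ i j, ContDiffOn ℝ ∞ (fun w => g w i j) {z | z ≠ 0})
    (hherm : ∀ z, z ≠ 0 → (g z).IsHermitian) (hz : z ≠ 0) (hmax : IsLocalMax (hopfTrace g) z)
    (k l : Fin n) : ddbar (hopfTrace g) z k l = (if l = k then 1 else 0) * (g z).trace -
      2 * star (z k) * z l * (g z).trace / (rSq z : ℂ) +
      (rSq z : ℂ) * wirt (-Complex.I) k (wirt Complex.I l fun w => (g w).trace) z := by
  have hR : (rSq z : ℂ) ≠ 0 := by exact_mod_cast (rSq_pos hz).ne'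
  have dr : ∀ w : Fin n → ℂ, DifferentiableAt ℝ (fun w : Fin n → ℂ => (rSq w : ℂ)) w :=
    contDiff_coe_rSq.differentiable (by simp)
  have hS := contDiffOn_trace hg
  have dS := hS.differentiableAt_punctured hz
  have dS' : DifferentiableAt ℝ (wirt Complex.I l fun w => (g w).trace) z :=
    hS.wirt.differentiableAt_punctured hz
  have e : ∀ w, w ≠ 0 → wirt Complex.I l (fun w => (hopfTrace g w : ℂ)) w =
      w l * (g w).trace + (rSq w : ℂ) * wirt Complex.I l (fun w => (g w).trace) w :=
    fun w hw => by
      rw [wirt_congr_on (fun w hw => coe_hopfTrace (hherm w hw)) hw,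
        wirt_mul (dr w) (hS.differentiableAt_punctured hw), wirtingerBar_rSq]
  rw [ddbar, Matrix.of_apply, wirtinger_eq_wirt, wirtingerBar_eq_wirt, wirt_congr_on e hz,
    wirt_add ((differentiableAt_coord l).fun_mul dS) ((dr z).fun_mul dS'),
    wirt_mul (differentiableAt_coord l) dS, wirt_mul (dr z) dS', wirtinger_rSq, wirt_coord,
    wirt_trace_of_isLocalMax hg hherm hz hmax, wirt_trace_of_isLocalMax hg hherm hz hmax,
    wirtinger_rSq, wirtingerBar_rSq]
  split_ifs
  · simp only [neg_mul, Complex.I_mul_I, neg_neg]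
    field_simp
    ring
  · field_simp
    ring

/-- The key estimate. Where `tr_{ω_H} ω ≥ 2` has a local maximum, its time derivative under the
Chern-Ricci flow is nonpositive. The terms coming from the torsion in the commutation formula, in
the Cauchy-Schwarz inequality and in the Hessian combine to `(2 - u) (tr H - p) - (n - 1)² p / u`
up to a positive factor, where `u = tr_{ω_H} ω`, `H = g⁻¹` and `0 ≤ p ≤ tr H`. -/
theorem sum_ddbar_log_det_nonpos (ht : SameTorsion g (hopfForm n))
    (hg : ∀ i j, ContDiffOn ℝ ∞ (fun w => g w i j) {z | z ≠ 0})
    (hpos : ∀ z, z ≠ 0 → (g z).PosDef) (hz : z ≠ 0) (hmax : IsLocalMax (hopfTrace g) z)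
    (h2 : 2 ≤ hopfTrace g z) :
    (∑ i, ddbar (fun w => Real.log (g w).det.re) z i i).re ≤ 0 := by
  have hherm : ∀ z, z ≠ 0 → (g z).IsHermitian := fun z hz => (hpos z hz).isHermitian
  have hRpos := rSq_pos hz
  have hRne : (rSq z : ℂ) ≠ 0 := by exact_mod_cast hRpos.ne'
  set H := (g z)⁻¹ with hH
  have hHpsd : H.PosSemidef := (hpos z hz).inv.posSemidef
  set R := rSq z with hRdef
  set u := hopfTrace g z with hu
  set S := (g z).trace.re with hSdef
  have huS : u = R * S := rfl
  have hSpos : 0 < S := by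
    by_contra! h
    have : R * S ≤ 0 := mul_nonpos_of_nonneg_of_nonpos hRpos.le h
    linarith
  have hStr : (g z).trace = (S : ℂ) := (hherm z hz).trace_eq_re
  have hI : star (-Complex.I) = Complex.I := by simp
  set A : Fin n → Matrix (Fin n) (Fin n) ℂ := fun i => wirtMatrix (-Complex.I) i g z with hA
  have hAconj : ∀ i, wirtMatrix Complex.I i g z = (A i).conjTranspose := fun i => by
    ext a b
    have := wirt_apply_conj hherm hz (-Complex.I) i b a
    rw [hI] at this
    simpa [wirtMatrix, A] using this
  set K : Matrix (Fin n) (Fin n) ℂ :=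
    ∑ i, wirtMatrix (-Complex.I) i (wirtMatrix Complex.I i g) z with hK
  -- `K` is the matrix of `∑ i, ∂_i ∂_ī g`; it is known from the commutation formula.
  have hlhs : ∑ i, ddbar (fun w => Real.log (g w).det.re) z i i =
      (H * K).trace - ∑ i, (H * A i * H * (A i).conjTranspose).trace := by
    rw [hK, Finset.mul_sum, Matrix.trace_sum, ← Finset.sum_sub_distrib]
    refine Finset.sum_congr rfl fun i _ => ?_
    rw [ddbar, Matrix.of_apply, wirtinger_eq_wirt, wirtingerBar_eq_wirt,
      wirt_wirt_log_det hg hpos hz, hAconj]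
  -- At the maximum, `K` is the Hessian `U` of `u`, up to a factor, plus explicit terms.
  set U := ddbar (hopfTrace g) z with hU
  set x : Fin n → ℂ := star z with hx
  have hKeq : K = ((R⁻¹ : ℝ) : ℂ) • U +
      (((2 - u) / R ^ 2 : ℝ) : ℂ) • (1 : Matrix (Fin n) (Fin n) ℂ) +
      (((2 * u - 2 * n) / R ^ 3 : ℝ) : ℂ) • Matrix.vecMulVec x (star x) := by
    ext k l
    have e1 : K k l = ∑ i, wirt (-Complex.I) i (wirt Complex.I i fun w => g w k l) z := by
      rw [hK, Matrix.sum_apply]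
      rfl
    have e2 := ddbar_hopfTrace_of_isLocalMax hg hherm hz hmax k l
    rw [e1, ht.sum_wirt_wirt hg hherm hz]
    simp only [Matrix.add_apply, Matrix.smul_apply, smul_eq_mul, Matrix.vecMulVec_apply,
      Matrix.one_apply, hU, e2, hStr, huS, ← hRdef, hx, star_star, Pi.star_apply,
      eq_comm (a := l) (b := k)]
    push_cast
    split_ifs <;> field_simp <;> ring
  set P := (star x ⬝ᵥ H.mulVec x).re with hP
  have hHK : (H * K).trace.re = R⁻¹ * (H * U).trace.re + (2 - u) / R ^ 2 * H.trace.re +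
      (2 * u - 2 * n) / R ^ 3 * P := by
    rw [hKeq]
    simp only [Matrix.mul_add, Matrix.mul_smul, Matrix.trace_add, Matrix.trace_smul, Matrix.mul_one,
      smul_eq_mul, Complex.add_re, Complex.re_ofReal_mul, Matrix.mul_vecMulVec,
      Matrix.trace_vecMulVec]
    rw [dotProduct_comm]
  have hHU : (H * U).trace.re ≤ 0 := by
    have := hHpsd.re_trace_mul_nonneg (K := -U) fun v => by
      rw [Matrix.neg_mulVec, dotProduct_neg, Complex.neg_re]
      exact neg_nonneg.2 (hmax.ddbar_nonpos (contDiffOn_hopfTrace hg) hz v)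
    rw [Matrix.mul_neg, Matrix.trace_neg, Complex.neg_re] at this
    linarith
  -- The contraction `∑ i, ∂_i g_kī` is a real multiple of `x = z̄`, since `∂_k (∑ i, g_iī)` is one
  -- at the maximum and so is the trace of the torsion.
  set lam : ℝ := -(u - (n - 1)) / R ^ 2 with hlam
  have hX : ∀ k, ((lam : ℂ) • x) k = ∑ i, A i k i := fun k => by
    have e1 : ∑ i, (wirt (-Complex.I) k (fun w => g w i i) z - A i k i) =
        (n - 1) * wirt (-Complex.I) k (fun w => ((1 / rSq w : ℝ) : ℂ)) z := by
      simp only [A, wirtMatrix, Matrix.of_apply, ht.wirtinger_sub hz k _ _, if_true, one_mul,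
        Finset.sum_sub_distrib, Finset.sum_const, Finset.card_univ, Fintype.card_fin, nsmul_eq_mul,
        ite_mul, zero_mul, Finset.sum_ite_eq, Finset.mem_univ, sub_mul]
    have e2 : wirt (-Complex.I) k (fun w => (g w).trace) z =
        ∑ i, wirt (-Complex.I) k (fun w => g w i i) z :=
      wirt_sum _ fun i _ => (hg i i).differentiableAt_punctured hz
    rw [Finset.sum_sub_distrib, ← e2, wirt_trace_of_isLocalMax hg hherm hz hmax,
      wirt_one_div_rSq _ _ hz, wirtinger_rSq, hStr] at e1
    have e3 : ∑ i, A i k i = -star (z k) * S / R - (n - 1) * (-star (z k) / (R : ℂ) ^ 2) := by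
      linear_combination -e1
    rw [e3, hlam, huS]
    simp only [Pi.smul_apply, smul_eq_mul, hx, Pi.star_apply]
    push_cast
    field_simp
    ring
  set T := ∑ i, (H * A i * H * (A i).conjTranspose).trace.re with hT
  have hCS : lam ^ 2 * P ≤ S * T := by
    have h := (hpos z hz).re_contraction_le A hX hSpos
    have e : (star ((lam : ℂ) • x) ⬝ᵥ H.mulVec ((lam : ℂ) • x)).re = lam ^ 2 * P := by
      rw [star_smul, Matrix.mulVec_smul, smul_dotProduct, dotProduct_smul, smul_eq_mul, smul_eq_mul,
        Complex.star_def, Complex.conj_ofReal, Complex.re_ofReal_mul, Complex.re_ofReal_mul, hP]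
      ring
    rw [← hH, e] at h
    exact h
  have hP0 : 0 ≤ P := (Complex.le_def.1 (hHpsd.dotProduct_mulVec_nonneg x)).1
  have hxx : star x ⬝ᵥ x = (R : ℂ) := by
    rw [hx, star_star, hRdef, ofReal_rSq]
    rfl
  have hPtr : P ≤ H.trace.re * R := by
    have h := (Complex.le_def.1 ((hHpsd.smul_one_sub le_rfl).dotProduct_mulVec_nonneg x)).1
    rw [Matrix.sub_mulVec, dotProduct_sub, Matrix.smul_mulVec, Matrix.one_mulVec, dotProduct_smul,
      hxx, smul_eq_mul, Complex.sub_re, Complex.re_ofReal_mul, Complex.ofReal_re] at h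
    simpa using h
  rw [hlhs, Complex.sub_re, Complex.re_sum, ← hT, hHK]
  have hTge : lam ^ 2 * P / S ≤ T := (div_le_iff₀' hSpos).2 hCS
  have hUle : R⁻¹ * (H * U).trace.re ≤ 0 :=
    mul_nonpos_of_nonneg_of_nonpos (inv_nonneg.2 hRpos.le) hHU
  have hid : (2 - u) / R ^ 2 * H.trace.re + (2 * u - 2 * n) / R ^ 3 * P - lam ^ 2 * P / S =
      -((u - 2) * (H.trace.re * R - P) / R ^ 3) - (n - 1) ^ 2 * P / (R ^ 4 * S) := by
    rw [hlam, huS]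
    field_simp
    ring
  have h3 : 0 ≤ (u - 2) * (H.trace.re * R - P) / R ^ 3 :=
    div_nonneg (mul_nonneg (by linarith) (by linarith)) (by positivity)
  have h4 : 0 ≤ ((n : ℝ) - 1) ^ 2 * P / (R ^ 4 * S) := by positivity
  linarith

end Spatial

/-! ### Preservation of the torsion along the flow -/

section Torsion

variable {n : ℕ}

/-- Adding `√-1 ∂∂̄ f` does not change the torsion. -/
lemma sameTorsion_add_ddbar {h : FormCoeff n} {f : (Fin n → ℂ) → ℝ}
    (hh : ∀ i j, ContDiffOn ℝ ∞ (fun w => h w i j) {z | z ≠ 0})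
    (hf : ContDiffOn ℝ ∞ f {z | z ≠ 0}) : SameTorsion (h + ddbar f) h := by
  intro z hz k i j
  have hf' : ContDiffOn ℝ ∞ (fun w => (f w : ℂ)) {z | z ≠ 0} :=
    Complex.ofRealCLM.contDiff.comp_contDiffOn hf
  have dh (a b : Fin n) := (hh a b).differentiableAt_punctured hz
  have e (a b : Fin n) : (fun w => (h + ddbar f) w a b) = fun w =>
      h w a b + wirt (-Complex.I) a (wirt Complex.I b fun w => (f w : ℂ)) w := by
    ext w
    simp [ddbar, wirtinger_eq_wirt, wirtingerBar_eq_wirt]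
  rw [e, e, wirt_add (dh _ _) (hf'.wirt.wirt.differentiableAt_punctured hz),
    wirt_add (dh _ _) (hf'.wirt.wirt.differentiableAt_punctured hz),
    wirt_comm (k := k) (l := i) hf'.wirt hz]
  ring

/-- The spatial derivatives of a function that is smooth on `[0, T) × (ℂⁿ \ {0})` commute with its
time derivative, also at the initial time. -/
lemma hasDerivWithinAt_wirt {T : ℝ} {F : ℝ × (Fin n → ℂ) → ℂ} {G : ℝ → (Fin n → ℂ) → ℂ}
    (hF : ContDiffOn ℝ ∞ F (Ico 0 T ×ˢ {z | z ≠ 0}))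
    (hG : ∀ t ∈ Ico 0 T, ∀ z, z ≠ 0 → HasDerivWithinAt (fun s => F (s, z)) (G t z) (Ico 0 T) t)
    (c : ℂ) (k : Fin n) {t : ℝ} (ht : t ∈ Ico 0 T) {z : Fin n → ℂ} (hz : z ≠ 0) :
    HasDerivWithinAt (fun s => wirt c k (fun w => F (s, w)) z) (wirt c k (G t) z) (Ico 0 T) t := by
  set Ω : Set (Fin n → ℂ) := {z | z ≠ 0} with hΩ
  set S : Set (ℝ × (Fin n → ℂ)) := Ico 0 T ×ˢ Ω with hS
  have hU : UniqueDiffOn ℝ S := (uniqueDiffOn_Ico 0 T).prod isOpen_punctured.uniqueDiffOn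
  set D := fderivWithin ℝ F S with hD
  have hDs : ContDiffOn ℝ ∞ D S := hF.fderivWithin hU (by simp)
  have hFD : ∀ p ∈ S, HasFDerivWithinAt F (D p) S p := fun p hp =>
    (hF.differentiableOn (by simp) p hp).hasFDerivWithinAt
  -- Derivatives on `S` restrict to the two slices through a point.
  have space {V : Type} [NormedAddCommGroup V] [NormedSpace ℝ V] {f : ℝ × (Fin n → ℂ) → V}
      {f' : ℝ × (Fin n → ℂ) →L[ℝ] V} {s : ℝ} {w : Fin n → ℂ} (hs : s ∈ Ico 0 T) (hw : w ≠ 0)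
      (h : HasFDerivWithinAt f f' S (s, w)) :
      HasFDerivAt (fun w => f (s, w)) (f'.comp (ContinuousLinearMap.inr ℝ ℝ (Fin n → ℂ))) w :=
    (h.comp w (hasFDerivAt_prodMk_right s w).hasFDerivWithinAt fun y hy => ⟨hs, hy⟩).hasFDerivAt
      (isOpen_punctured.mem_nhds hw)
  have time {V : Type} [NormedAddCommGroup V] [NormedSpace ℝ V] {f : ℝ × (Fin n → ℂ) → V}
      {f' : ℝ × (Fin n → ℂ) →L[ℝ] V} {s : ℝ} {w : Fin n → ℂ} (hw : w ≠ 0)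
      (h : HasFDerivWithinAt f f' S (s, w)) :
      HasDerivWithinAt (fun s => f (s, w)) (f' (1, 0)) (Ico 0 T) s := by
    exact h.comp_hasDerivWithinAt (f := fun s => (s, w)) s
      ((hasDerivWithinAt_id s _).prodMk (hasDerivWithinAt_const s _ w)) fun y hy => ⟨hy, hw⟩
  have hGeq : ∀ w, w ≠ 0 → G t w = D (t, w) (1, 0) := fun w hw =>
    (uniqueDiffOn_Ico 0 T t ht).eq_deriv _ (hG t ht w hw) (time hw (hFD (t, w) ⟨ht, hw⟩))
  have hmem : (t, z) ∈ S := ⟨ht, hz⟩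
  set D2 := fderivWithin ℝ D S (t, z) with hD2
  have hDD : HasFDerivWithinAt D D2 S (t, z) :=
    (hDs.differentiableOn (by simp) _ hmem).hasFDerivWithinAt
  have hclos : (t, z) ∈ closure (interior S) := by
    rw [hS, interior_prod_eq, closure_prod_eq, interior_Ico, isOpen_punctured.interior_eq,
      closure_Ioo (ht.1.trans_lt ht.2).ne]
    exact ⟨Ico_subset_Icc_self ht, subset_closure hz⟩
  have hsymm : IsSymmSndFDerivWithinAt ℝ F S (t, z) :=
    (hF _ hmem).isSymmSndFDerivWithinAt
      (by simp only [minSmoothness_of_isRCLikeNormedField]; exact WithTop.coe_le_coe.2 le_top)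
      hU hclos hmem
  have hspace : ∀ s ∈ Ico 0 T, wirt c k (fun w => F (s, w)) z =
      (D (s, z) (0, Pi.single k 1) + c * D (s, z) (0, Pi.single k Complex.I)) / 2 :=
    fun s hs => by
      rw [(space hs hz (hFD (s, z) ⟨hs, hz⟩)).wirt_eq]
      rfl
  have htime (v : Fin n → ℂ) : HasDerivWithinAt (fun s => D (s, z) (0, v)) (D2 (1, 0) (0, v))
      (Ico 0 T) t :=
    time (f := fun p => D p (0, v)) (f' := D2.flip (0, v)) hz (by
      simpa using hDD.clm_apply (hasFDerivWithinAt_const (0, v) (t, z) S))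
  have hGk : wirt c k (G t) z =
      (D2 (1, 0) (0, Pi.single k 1) + c * D2 (1, 0) (0, Pi.single k Complex.I)) / 2 := by
    have h : HasFDerivAt (fun w => D (t, w) (1, 0)) _ z :=
      space (f := fun p => D p (1, 0)) (f' := D2.flip (1, 0)) ht hz (by
        simpa using hDD.clm_apply (hasFDerivWithinAt_const ((1 : ℝ), (0 : Fin n → ℂ)) (t, z) S))
    rw [wirt_congr_on hGeq hz, h.wirt_eq]
    have hs (v : Fin n → ℂ) : D2 (1, 0) (0, v) = D2 (0, v) (1, 0) := hsymm (1, 0) (0, v)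
    rw [hs, hs]
    rfl
  rw [hGk]
  exact (((htime _).add ((htime _).const_mul c)).div_const 2).congr hspace (hspace t ht)

/-- Along the flow the torsion does not change, since the Chern-Ricci form is `∂∂̄`-exact on
`ℂⁿ \ {0}`. -/
lemma IsChernRicciFlow.sameTorsion {α : Fin n → ℂ} {g₀ h : FormCoeff n} {T : ℝ}
    {g : ℝ → FormCoeff n} (hg : IsChernRicciFlow α g₀ T g) (h₀ : SameTorsion g₀ h) {t : ℝ}
    (ht : t ∈ Ico 0 T) : SameTorsion (g t) h := by
  intro z hz k i j
  have h0 : (0 : ℝ) ∈ Ico 0 T := ⟨le_rfl, ht.1.trans_lt ht.2⟩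
  set τ : ℝ → ℂ := fun s => wirt (-Complex.I) k (fun w => g s w i j) z -
    wirt (-Complex.I) i (fun w => g s w k j) z with hτ
  have hτ' : ∀ s ∈ Ico 0 T, HasDerivWithinAt τ 0 (Ico 0 T) s := by
    intro s hs
    have hF : ContDiffOn ℝ ∞ (fun w => (Real.log (g s w).det.re : ℂ)) {z | z ≠ 0} :=
      Complex.ofRealCLM.contDiff.comp_contDiffOn
        (contDiffOn_log_det (hg.metric s hs).smooth (hg.metric s hs).posDef)
    have key (a b m : Fin n) := hasDerivWithinAt_wirt (hg.smooth a b)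
      (G := fun s w => -(chernRicci (g s) w a b))
      (fun s hs w hw => hg.flow s hs w hw a b) (-Complex.I) m hs hz
    have e (a b : Fin n) : (fun w => -(chernRicci (g s) w a b)) =
        wirt (-Complex.I) a (wirt Complex.I b fun w => (Real.log (g s w).det.re : ℂ)) := by
      ext w
      simp [chernRicci, ddbar, wirtinger_eq_wirt, wirtingerBar_eq_wirt]
    have := (key i j k).sub (key k j i)
    rw [e, e, wirt_comm hF.wirt hz, sub_self] at this
    exact this
  have hconst : τ t = τ 0 := by
    have := (convex_Ico 0 T).norm_image_sub_le_of_norm_hasDerivWithin_le (C := 0) hτ'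
      (fun _ _ => by simp) h0 ht
    rw [zero_mul] at this
    exact sub_eq_zero.1 (norm_le_zero_iff.1 this)
  have hinit (a b m : Fin n) : wirt (-Complex.I) m (fun w => g 0 w a b) z =
      wirt (-Complex.I) m (fun w => g₀ w a b) z :=
    wirt_congr_on (fun w hw => by rw [hg.initial w hw]) hz
  have h1 := h₀ z hz k i j
  rw [← hinit, ← hinit] at h1
  exact hconst.trans h1

end Torsion

/-! ### Compactness of the Hopf manifold -/

section Compactness

variable {n : ℕ} {α : Fin n → ℂ} {ρ : ℝ}

lemma norm_zpow_mul (hα : ∀ i, ‖α i‖ = ρ) (hρ : 0 < ρ) (m : ℤ) (z : Fin n → ℂ) :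
    ‖α ^ m * z‖ = ρ ^ m * ‖z‖ := by
  have h : ‖α ^ m * z‖ = ‖(ρ ^ m) • z‖ := by
    simp only [Pi.norm_def]
    congr 2
    ext i
    simp [hα, abs_of_pos hρ]
  rw [h, norm_smul, Real.norm_of_nonneg (zpow_nonneg hρ.le m)]

lemma apply_zpow_mul {f : (Fin n → ℂ) → ℝ} (hα : ∀ i, α i ≠ 0)
    (hf : ∀ z, z ≠ 0 → f (α * z) = f z) (m : ℤ) {z : Fin n → ℂ} (hz : z ≠ 0) :
    f (α ^ m * z) = f z := by
  have hne : ∀ m : ℤ, α ^ m * z ≠ 0 := fun m h0 => hz <| by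
    ext i
    simpa [zpow_ne_zero m (hα i)] using congrFun h0 i
  have hstep : ∀ m : ℤ, f (α ^ (m + 1) * z) = f (α ^ m * z) := fun m => by
    rw [← hf _ (hne m)]
    congr 1
    ext i
    simp only [Pi.mul_apply, Pi.pow_apply, zpow_add_one₀ (hα i)]
    ring
  induction m using Int.induction_on with
  | zero => simp
  | succ m ih => rw [hstep, ih]
  | pred m ih => rw [← ih, ← hstep, sub_add_cancel]

/-- A compact annulus meets every orbit of `z ↦ α * z`. -/
lemma exists_isCompact_fundamental (hα : ∀ i, ‖α i‖ = ρ) (hρ : 0 < ρ) (hρ1 : ρ ≠ 1) :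
    ∃ K : Set (Fin n → ℂ), IsCompact K ∧ (∀ z ∈ K, z ≠ 0) ∧
      ∀ z, z ≠ 0 → ∃ m : ℤ, α ^ m * z ∈ K := by
  refine ⟨Metric.closedBall 0 (max ρ ρ⁻¹) ∩ {z | 1 ≤ ‖z‖},
    (isCompact_closedBall _ _).inter_right (isClosed_le continuous_const continuous_norm),
    fun z hz h0 => ?_, fun z hz => ?_⟩
  · have := hz.2
    rw [h0, mem_ofPred_eq, norm_zero] at this
    linarith
  · have hz' : 0 < ‖z‖ := norm_pos_iff.2 hz
    have key : ∃ m : ℤ, 1 ≤ ρ ^ m * ‖z‖ ∧ ρ ^ m * ‖z‖ ≤ max ρ ρ⁻¹ := by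
      have aux : ∀ b : ℝ, 1 < b → ∃ m : ℤ, 1 ≤ b ^ m * ‖z‖ ∧ b ^ m * ‖z‖ ≤ b := by
        intro b hb
        obtain ⟨m, h1, h2⟩ := exists_mem_Ico_zpow hz' hb
        have hbm : 0 < b ^ m := zpow_pos (by linarith) m
        refine ⟨-m, ?_, ?_⟩
        · rwa [zpow_neg, inv_mul_eq_div, one_le_div hbm]
        · rw [zpow_neg, inv_mul_eq_div, div_le_iff₀ hbm]
          rw [zpow_add_one₀ (by linarith), mul_comm] at h2
          exact h2.le
      rcases lt_or_gt_of_ne hρ1 with h | h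
      · obtain ⟨m, h1, h2⟩ := aux ρ⁻¹ ((one_lt_inv₀ hρ).2 h)
        refine ⟨-m, ?_, ?_⟩
        · rwa [zpow_neg, ← inv_zpow]
        · rw [zpow_neg, ← inv_zpow]
          exact h2.trans (le_max_right _ _)
      · obtain ⟨m, h1, h2⟩ := aux ρ h
        exact ⟨m, h1, h2.trans (le_max_left _ _)⟩
    obtain ⟨m, h1, h2⟩ := key
    refine ⟨m, ?_, ?_⟩
    · rwa [mem_closedBall_zero_iff, norm_zpow_mul hα hρ]
    · rwa [mem_ofPred_eq, norm_zpow_mul hα hρ]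

/-- `tr_{ω_H} ω` descends to the Hopf manifold. -/
lemma DescendsToHopf.hopfTrace_mul {g : FormCoeff n} (hg : DescendsToHopf α g)
    (hα : ∀ i, ‖α i‖ = ρ) {z : Fin n → ℂ} (hz : z ≠ 0) :
    hopfTrace g (α * z) = hopfTrace g z := by
  have hr : rSq (α * z) = ρ ^ 2 * rSq z := by
    simp only [rSq, Finset.mul_sum, Pi.mul_apply, norm_mul, hα, mul_pow]
  have hαα : ∀ i, α i * star (α i) = ((ρ ^ 2 : ℝ) : ℂ) := fun i => by
    rw [Complex.star_def, Complex.mul_conj, Complex.normSq_eq_norm_sq, hα]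
  have ht : (g z).trace.re = (g (α * z)).trace.re * ρ ^ 2 := by
    simp only [Matrix.trace, Matrix.diag_apply, Complex.re_sum, Finset.sum_mul]
    refine Finset.sum_congr rfl fun i _ => ?_
    rw [← hg z hz i i, hαα, Complex.re_mul_ofReal]
  rw [hopfTrace, hopfTrace, hr, ht]
  ring

end Compactness

/-! ### The parabolic maximum principle -/

section MaximumPrinciple

variable {n : ℕ} {α : Fin n → ℂ} {ρ : ℝ} {g₀ : FormCoeff n} {T : ℝ} {g : ℝ → FormCoeff n}

lemma IsChernRicciFlow.hasDerivWithinAt_hopfTrace (hg : IsChernRicciFlow α g₀ T g) {t : ℝ}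
    (ht : t ∈ Ico 0 T) {z : Fin n → ℂ} (hz : z ≠ 0) :
    HasDerivWithinAt (fun s => hopfTrace (g s) z)
      (rSq z * (∑ i, ddbar (fun w => Real.log (g t w).det.re) z i i).re) (Ico 0 T) t := by
  have h : HasDerivWithinAt (fun s => (g s z).trace)
      (∑ i, ddbar (fun w => Real.log (g t w).det.re) z i i) (Ico 0 T) t :=
    HasDerivWithinAt.fun_sum fun i _ => by simpa [chernRicci] using hg.flow t ht z hz i i
  exact (Complex.reCLM.hasFDerivAt.comp_hasDerivWithinAt t h).const_mul (rSq z)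

lemma IsChernRicciFlow.continuousOn_hopfTrace (hg : IsChernRicciFlow α g₀ T g) :
    ContinuousOn (fun p : ℝ × (Fin n → ℂ) => hopfTrace (g p.1) p.2)
      (Ico 0 T ×ˢ {z | z ≠ 0}) := by
  have h : ContinuousOn (fun p : ℝ × (Fin n → ℂ) => (g p.1 p.2).trace)
      (Ico 0 T ×ˢ {z | z ≠ 0}) :=
    continuousOn_finsetSum _ fun i _ => (hg.smooth i i).continuousOn
  exact (contDiff_rSq.continuous.comp continuous_snd).continuousOn.mul
    (Complex.continuous_re.comp_continuousOn h)

/-- The maximum principle for `tr_{ω_H} ω(t)`. -/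
theorem IsChernRicciFlow.hopfTrace_le (hg : IsChernRicciFlow α g₀ T g)
    (h₀ : SameTorsion g₀ (hopfForm n)) (hα : ∀ i, ‖α i‖ = ρ) (hρ : 0 < ρ) (hρ1 : ρ ≠ 1) {C : ℝ}
    (hC : 2 ≤ C) (hC₀ : ∀ z, z ≠ 0 → hopfTrace g₀ z ≤ C) {t : ℝ} (ht : t ∈ Ico 0 T)
    {z : Fin n → ℂ} (hz : z ≠ 0) : hopfTrace (g t) z ≤ C := by
  by_contra! hlt
  obtain ⟨K, hK, hK0, hKorb⟩ := exists_isCompact_fundamental hα hρ hρ1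
  have hαne : ∀ i, α i ≠ 0 := fun i => norm_pos_iff.1 ((hα i).symm ▸ hρ)
  have hinv : ∀ s ∈ Ico 0 T, ∀ w, w ≠ 0 → ∃ w' ∈ K, hopfTrace (g s) w' = hopfTrace (g s) w :=
    fun s hs w hw => by
      obtain ⟨m, hm⟩ := hKorb w hw
      exact ⟨_, hm, apply_zpow_mul hαne
        (fun y hy => (hg.metric s hs).descends.hopfTrace_mul hα hy) m hw⟩
  -- The maximum principle is applied to `tr_{ω_H} ω(t) - ε t`, for a strict inequality in time.
  obtain ⟨ε, hε, hεt⟩ := exists_pos_mul_lt (sub_pos.2 hlt) t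
  set Φ : ℝ × (Fin n → ℂ) → ℝ := fun p => hopfTrace (g p.1) p.2 - ε * p.1 with hΦ
  have hsub : Icc 0 t ×ˢ K ⊆ Ico 0 T ×ˢ {z : Fin n → ℂ | z ≠ 0} :=
    prod_mono (fun s hs => ⟨hs.1, hs.2.trans_lt ht.2⟩) hK0
  have hΦc : ContinuousOn Φ (Icc 0 t ×ˢ K) :=
    (hg.continuousOn_hopfTrace.mono hsub).sub (by fun_prop)
  obtain ⟨z', hz'K, hz'⟩ := hinv t ht z hz
  obtain ⟨⟨t₀, z₀⟩, hmem, hmax⟩ := (isCompact_Icc.prod hK).exists_isMaxOn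
    ⟨(t, z'), ⟨right_mem_Icc.2 ht.1, hz'K⟩⟩ hΦc
  obtain ⟨ht₀, hz₀K⟩ : t₀ ∈ Icc 0 t ∧ z₀ ∈ K := hmem
  have hz₀ : z₀ ≠ 0 := hK0 z₀ hz₀K
  have ht₀T : t₀ ∈ Ico 0 T := ⟨ht₀.1, ht₀.2.trans_lt ht.2⟩
  have hmax' : ∀ s ∈ Icc 0 t, ∀ w ∈ K,
      hopfTrace (g s) w - ε * s ≤ hopfTrace (g t₀) z₀ - ε * t₀ := fun s hs w hw => by
    simpa only [hΦ] using isMaxOn_iff.1 hmax (s, w) ⟨hs, hw⟩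
  have hbig : C < hopfTrace (g t₀) z₀ - ε * t₀ := by
    have := hmax' t (right_mem_Icc.2 ht.1) z' hz'K
    rw [hz'] at this
    linarith
  have ht₀pos : 0 < t₀ := by
    refine lt_of_le_of_ne ht₀.1 fun h => ?_
    have h1 := hC₀ z₀ hz₀
    rw [hopfTrace, ← hg.initial z₀ hz₀] at h1
    rw [← h, hopfTrace] at hbig
    linarith
  have hspace : IsLocalMax (hopfTrace (g t₀)) z₀ := by
    filter_upwards [isOpen_punctured.mem_nhds hz₀] with w hw
    obtain ⟨w', hw'K, hw'⟩ := hinv t₀ ht₀T w hw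
    have := hmax' t₀ ht₀ w' hw'K
    rw [hw'] at this
    linarith
  have h2 : 2 ≤ hopfTrace (g t₀) z₀ := by nlinarith
  have hR := sum_ddbar_log_det_nonpos (hg.sameTorsion h₀ ht₀T) (hg.metric t₀ ht₀T).smooth
    (hg.metric t₀ ht₀T).posDef hz₀ hspace h2
  have hderiv := ((hg.hasDerivWithinAt_hopfTrace ht₀T hz₀).sub
    ((hasDerivWithinAt_id t₀ (Ico 0 T)).const_mul ε)).mono
    (fun s hs => ⟨hs.1, hs.2.trans_lt ht₀T.2⟩ : Icc 0 t₀ ⊆ Ico 0 T)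
  have htime : IsLocalMaxOn (fun s => hopfTrace (g s) z₀ - ε * s) (Icc 0 t₀) t₀ :=
    IsMaxOn.localize fun s hs => hmax' s ⟨hs.1, hs.2.trans ht₀.2⟩ z₀ hz₀K
  have hcone : -t₀ ∈ posTangentConeAt (Icc 0 t₀) t₀ :=
    mem_posTangentConeAt_of_segment_subset (by
      rw [add_neg_cancel, segment_symm, segment_eq_Icc ht₀.1])
  have hnonneg := htime.hasFDerivWithinAt_nonpos hderiv.hasFDerivWithinAt hcone
  have hprod := mul_nonpos_of_nonneg_of_nonpos (rSq_pos hz₀).le hR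
  simp only [ContinuousLinearMap.toSpanSingleton_apply, smul_eq_mul] at hnonneg
  nlinarith

end MaximumPrinciple

theorem proposition1p9 (n : ℕ) (α : Fin n → ℂ) (hα₀ : α ≠ 0)
    (hα : ∃ ρ : ℝ, ρ ≠ 1 ∧ ∀ i, ‖α i‖ = ρ)
    (ψ : HopfManifold α → ℝ) (hψ : HopfManifold.IsSmooth ψ)
    (hg₀ : IsHermitianMetric α (hopfForm n + ddbar (HopfManifold.pullback ψ))) :
    ∃ C : ℝ, 0 < C ∧ ∀ g : ℝ → FormCoeff n,
      IsChernRicciFlow α (hopfForm n + ddbar (HopfManifold.pullback ψ)) (1 / (n : ℝ)) g →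
        ∀ t ∈ Set.Ico (0 : ℝ) (1 / (n : ℝ)), FormLE (g t) ((C : ℂ) • hopfForm n) := by
  obtain ⟨ρ, hρ1, hαρ⟩ := hα
  have hρ : 0 < ρ := by
    obtain ⟨i, hi⟩ := Function.ne_iff.1 hα₀
    exact hαρ i ▸ norm_pos_iff.2 hi
  have hαne : ∀ i, α i ≠ 0 := fun i => norm_pos_iff.1 ((hαρ i).symm ▸ hρ)
  set g₀ : FormCoeff n := hopfForm n + ddbar (HopfManifold.pullback ψ) with hg₀def
  have hhopf : ∀ i j, ContDiffOn ℝ ∞ (fun w => hopfForm n w i j) {z | z ≠ 0} := fun i j => by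
    by_cases h : i = j
    · simpa [hopfForm, h] using contDiffOn_one_div_rSq
    · simpa [hopfForm, h] using contDiffOn_const
  have htor : SameTorsion g₀ (hopfForm n) := sameTorsion_add_ddbar hhopf hψ
  obtain ⟨K, hK, hK0, hKorb⟩ := exists_isCompact_fundamental hαρ hρ hρ1
  obtain ⟨M, hM⟩ := hK.bddAbove_image ((contDiffOn_hopfTrace hg₀.smooth).continuousOn.mono hK0)
  have hC₀ : ∀ z, z ≠ 0 → hopfTrace g₀ z ≤ max 2 M := fun z hz => by
    obtain ⟨m, hm⟩ := hKorb z hz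
    rw [← apply_zpow_mul hαne (fun y hy => hg₀.descends.hopfTrace_mul hαρ hy) m hz]
    exact (hM (mem_image_of_mem _ hm)).trans (le_max_right _ _)
  refine ⟨max 2 M, lt_max_of_lt_left two_pos, fun g hg t ht z hz => ?_⟩
  have hle := hg.hopfTrace_le htor hαρ hρ hρ1 (le_max_left _ _) hC₀ ht hz
  have htr : (g t z).trace.re ≤ max 2 M / rSq z := by
    rwa [le_div_iff₀' (rSq_pos hz)]
  have e : (((max 2 M : ℝ) : ℂ) • hopfForm n) z =
      ((max 2 M / rSq z : ℝ) : ℂ) • (1 : Matrix (Fin n) (Fin n) ℂ) := by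
    ext i j
    simp only [Pi.smul_apply, Matrix.smul_apply, hopfForm, Matrix.of_apply, Matrix.one_apply,
      smul_eq_mul]
    split_ifs
    · push_cast
      ring
    · simp
  rw [e]
  exact ((hg.metric t ht).posDef z hz).posSemidef.smul_one_sub htr
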